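/- Let $\widetilde{P}_4(\xi) = \bigl(\sum_{j=1}^4 \xi_j\bigr)^3 - \sum_{j=1}^4 \xi_j^3$ for $\xi \in \mathbb{R}^4$. (1) There exist a function $\psi \in C_0^\infty(\mathbb{R}^4)$ with $\psi(0) \neq 0$ and a constant $c_\psi \neq 0$ such that $$\int_{\mathbb{R}^4} e^{i\lambda \widetilde{P}_4(\xi)}\,\psi(\xi)\,d\xi = c_\psi\,\lambda^{-4/3} + O\bigl(\lambda^{-3/2}\log\lambda\bigr) \quad \text{as } \lambda \to +\infty.$$ (2) Consequently the decay rate $\lambda^{-11/6}$ is sharp for the phase $P_4(z) = \widetilde{P}_4(z_1,z_2,z_3,z_4) + q z_5^2$ on $\mathbb{R}^5$, where $q$ is any nonzero real number, in the following sense: for every neighbourhood $U$ of the origin in $\mathbb{R}^5$ there exist $\psi \in C_0^\infty(U)$ with $\psi(0) \neq 0$ and a constant $c \neq 0$ such that $$\int_{\mathbb{R}^5} e^{i\lambda P_4(z)}\,\psi(z)\,dz = c\,\lambda^{-11/6} + O\bigl(\lambda^{-2}\log\lambda\bigr) \quad \text{as } \lambda \to +\infty.$$ In both parts $\psi$ can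 be taken real-valued; the constants $c_\psi$ and $c$ are complex numbers. -/

import Mathlib

open MeasureTheory Filter Asymptotics Topology
open scoped ContDiff

/-- The oscillatory integral with phase `S` and amplitude `ψ`: the integral over `ℝ^d`
of `exp (i t S(ξ)) ψ(ξ)`, with respect to Lebesgue measure. -/
noncomputable def oscillatoryIntegral {d : ℕ} (S ψ : (Fin d → ℝ) → ℝ) (t : ℝ) : ℂ :=
  ∫ ξ : Fin d → ℝ, Complex.exp (Complex.I * (t : ℂ) * (S ξ : ℂ)) * (ψ ξ : ℂ)

/-- The cubic form `(ξ₁ + ξ₂ + ξ₃ + ξ₄)³ - (ξ₁³ + ξ₂³ + ξ₃³ + ξ₄³)` on `ℝ⁴`. -/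
def cubicP4 (ξ : Fin 4 → ℝ) : ℝ :=
  (∑ j, ξ j) ^ 3 - ∑ j, ξ j ^ 3

/-- The phase on `ℝ⁵` obtained by adding to the cubic form in `(z₁, z₂, z₃, z₄)` the quadratic
form `q z₅²` in the remaining variable; this form is nondegenerate exactly when `q ≠ 0`. -/
def phaseP4 (q : ℝ) (z : Fin 5 → ℝ) : ℝ :=
  cubicP4 (fun j : Fin 4 => z j.castSucc) + q * z (Fin.last 4) ^ 2

/-!
In the variables `u = ξ₁ + ξ₂`, `w = ξ₃ + ξ₄`, `v = ξ₁ - ξ₂`, `z = ξ₃ - ξ₄` the cubic form becomes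
`Q(u, w) - (3/4) (u v² + w z²)` with `Q(u, w) = (3/4) (u + w) (u² + 3 u w + w²)` (`cubicP4_eq`).
The amplitude is `χ(u² + w²) χ(v²) χ(z²)` for a cutoff `χ`, which may have arbitrarily small
support.

By Fubini the integrals in `v` and `z` are truncated Fresnel integrals with parameters proportional
to `t u` and `t w`. A truncated integral `∫₀^∞ α(r) exp (i μ r ^ p) dr` equals
`Γ(1 / p + 1) (i / μ) ^ (1 / p)` up to `O(|μ| ^ (-s))` for every `1 / p ≤ s ≤ 1`
(`IsCutoff.exists_norm_sub_fresnel_le_rpow`); this is proved by damping the phase, evaluating the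
full damped integral by analytic continuation, and integrating by parts away from the origin.
Replacing both Fresnel integrals by their leading terms, of size `|t u| ^ (-1/2)` and
`|t w| ^ (-1/2)`, costs `O(t ^ (-3/2) log t)`
(`IsCutoff.exists_norm_integral_sub_integral_fresnel_le`).

What remains is `t⁻¹` times a planar integral of `exp (i t Q(u, w))` against a kernel homogeneous of
degree `-1`. In polar coordinates the radial integral is a truncated Fresnel integral of order `3`,
with parameter `t Q(cos θ, sin θ)`, and its leading term produces `t ^ (-4/3)`. The remainder is
`O(t ^ (-3/2))` because `|cos θ sin θ Q(cos θ, sin θ)| ^ (-1/2)` is integrable: the five linear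
factors have simple and distinct zeros on the circle (`exists_norm_integral_sumCubic_sub_le`).

The leading coefficient is nonzero because almost every value of its angular integrand has positive real
part (`re_angularDensity_mul_fresnel_pos`): the phases of the three factors add up to `± π / 3` when
`u` and `w` have the same sign, and to `± π / 6` when they have opposite signs.

On `ℝ⁵` the extra variable contributes one more Fresnel factor, `c t ^ (-1/2) + O(t⁻¹)`.
-/

/-! ### Damped Fresnel integrals -/

open Set ProbabilityTheory in
/-- The Gamma-type integral of `exp (-ρ r ^ p)` over the half-line for complex `ρ`, by analytic
continuation from real `ρ`: the left side is the complex moment generating function of `-r ^ p`. -/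
theorem integral_cexp_neg_mul_pow {p : ℕ} (hp : p ≠ 0) {ρ : ℂ} (hρ : 0 < ρ.re) :
    ∫ r in Ioi (0 : ℝ), Complex.exp (-ρ * r ^ p) =
      Real.Gamma (1 / p + 1) * (1 / ρ) ^ (1 / p : ℂ) := by
  have hp0 : (0 : ℝ) < p := by positivity
  set μ : Measure ℝ := volume.restrict (Ioi 0)
  set X : ℝ → ℝ := fun r => -r ^ p
  set U : Set ℂ := {z | 0 < z.re}
  have hU : Ioi (0 : ℝ) ⊆ interior (integrableExpSet X μ) := by
    refine interior_maximal (fun b hb => ?_) isOpen_Ioi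
    have := integrableOn_rpow_mul_exp_neg_mul_rpow (s := 0) (p := p) (by norm_num) hp0 hb
    simpa [integrableExpSet, IntegrableOn, X, μ] using this
  have hF : AnalyticOnNhd ℂ (complexMGF X μ) U := fun z hz =>
    analyticOnNhd_complexMGF z (hU hz)
  have hG : AnalyticOnNhd ℂ
      (fun z => (Real.Gamma (1 / p + 1) : ℂ) * (1 / z) ^ (1 / p : ℂ)) U := by
    intro z hz
    have hz0 : z ≠ 0 := by rintro rfl; simp [U] at hz
    refine analyticAt_const.mul (AnalyticAt.cpow (analyticAt_const.div analyticAt_id hz0)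
      analyticAt_const ?_)
    left
    simp only [one_div, Complex.inv_re]
    exact div_pos hz (Complex.normSq_pos.2 hz0)
  have hreal : ∀ b : ℝ, 0 < b → complexMGF X μ b =
      (Real.Gamma (1 / p + 1) : ℂ) * (1 / (b : ℂ)) ^ (1 / p : ℂ) := by
    intro b hb
    rw [complexMGF_ofReal, mgf]
    have := integral_exp_neg_mul_rpow hp0 hb
    have h2 : (1 / b) ^ (1 / (p : ℝ)) = b ^ (-1 / (p : ℝ)) := by
      rw [one_div b, Real.inv_rpow hb.le, ← Real.rpow_neg hb.le, neg_div]
    have h3 : (1 / (b : ℂ)) ^ (1 / p : ℂ) = ((b ^ (-1 / (p : ℝ)) : ℝ) : ℂ) := by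
      rw [← h2, Complex.ofReal_cpow (by positivity)]
      push_cast; rfl
    rw [h3, ← Complex.ofReal_mul, mul_comm, ← this]
    congr 1
    refine integral_congr_ae (Eventually.of_forall fun r => ?_)
    simp [X]
  have hone : (1 : ℂ) ∈ U := by simp [U]
  have key := hF.eqOn_of_preconnected_of_frequently_eq hG
    (convex_halfSpace_re_gt 0).isPreconnected hone ?_ hρ
  · refine Eq.trans ?_ key
    rw [complexMGF]
    refine integral_congr_ae (Eventually.of_forall fun r => ?_)
    simp [X]
  · have ht : Tendsto (fun x : ℝ => (x : ℂ)) (𝓝[>] 1) (𝓝[≠] 1) := by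
      refine tendsto_nhdsWithin_iff.2 ⟨?_, ?_⟩
      · exact (Complex.continuous_ofReal.tendsto' 1 1 (by simp)).mono_left nhdsWithin_le_nhds
      · filter_upwards [self_mem_nhdsWithin] with x hx
        simpa using (ne_of_gt hx)
    refine ht.frequently (Eventually.frequently ?_)
    filter_upwards [self_mem_nhdsWithin] with x hx
    exact hreal x (lt_trans one_pos hx)

/-! ### Cutoffs and integration by parts -/

/-- A smooth, compactly supported function on the line that equals `1` near the origin. -/
structure IsCutoff (α : ℝ → ℝ) : Prop where
  contDiff : ContDiff ℝ ∞ α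
  hasCompactSupport : HasCompactSupport α
  eventually_eq_one : ∀ᶠ r in 𝓝 0, α r = 1

theorem IsCutoff.exists_abs_le {α : ℝ → ℝ} (hα : IsCutoff α) : ∃ B, 0 ≤ B ∧ ∀ r, |α r| ≤ B := by
  obtain ⟨B, hB⟩ := hα.hasCompactSupport.exists_bound_of_continuous hα.contDiff.continuous
  exact ⟨B, (norm_nonneg _).trans (hB 0), hB⟩

theorem norm_cexp_neg_mul_pow_le_one {ρ : ℂ} (hρ : 0 ≤ ρ.re) {r : ℝ} (hr : 0 ≤ r) (p : ℕ) :
    ‖Complex.exp (-ρ * r ^ p)‖ ≤ 1 := by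
  rw [Complex.norm_exp, Real.exp_le_one_iff]
  have : (-ρ * (r : ℂ) ^ p).re = -(ρ.re * r ^ p) := by
    rw [← Complex.ofReal_pow, Complex.re_mul_ofReal, Complex.neg_re, neg_mul]
  rw [this]
  have := mul_nonneg hρ (pow_nonneg hr p)
  linarith

open Set in
theorem integrableOn_cexp_neg_mul_pow {p : ℕ} (hp : p ≠ 0) {ρ : ℂ} (hρ : 0 < ρ.re) :
    IntegrableOn (fun r : ℝ => Complex.exp (-ρ * r ^ p)) (Ioi 0) := by
  have hp0 : (0 : ℝ) < p := by positivity
  have := integrableOn_rpow_mul_exp_neg_mul_rpow (s := 0) (p := p) (by norm_num) hp0 hρ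
  refine Integrable.mono' this (by fun_prop) (Eventually.of_forall fun r => ?_)
  rw [Complex.norm_exp, ← Complex.ofReal_pow, Complex.re_mul_ofReal]
  simp

open Set in
/-- Away from the critical point `0` of the phase, one integration by parts gains a factor `1 / ρ`,
uniformly in the damping `ρ.re > 0`. -/
theorem IsCutoff.exists_norm_integral_one_sub_le {α : ℝ → ℝ} (hα : IsCutoff α) {p : ℕ}
    (hp : 2 ≤ p) :
    ∃ C, 0 ≤ C ∧ ∀ ρ : ℂ, 0 < ρ.re →
      ‖∫ r in Ioi (0 : ℝ), ((1 - α r : ℝ) : ℂ) * Complex.exp (-ρ * r ^ p)‖ ≤ C / ‖ρ‖ := by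
  obtain ⟨n, rfl⟩ : ∃ n, p = n + 1 := ⟨p - 1, by omega⟩
  have hn : 1 ≤ n := by omega
  obtain ⟨ε, hε, hone⟩ := Metric.eventually_nhds_iff.1 hα.eventually_eq_one
  -- Halving the radius makes `α = 1` at the endpoint `δ` too.
  set δ := ε / 2
  have hδ : 0 < δ := by positivity
  have hone' : ∀ r, 0 < r → r ≤ δ → α r = 1 := fun r h0 h1 => hone (by
    rw [Real.dist_eq, sub_zero, abs_of_pos h0]; simp only [δ] at h1; linarith)
  have hdiff : Differentiable ℝ α := hα.contDiff.differentiable (by simp)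
  have hcont' : Continuous (deriv α) := hα.contDiff.continuous_deriv (by simp)
  obtain ⟨B, hB0, hB⟩ := hα.exists_abs_le
  obtain ⟨A, hA⟩ := (hα.hasCompactSupport.deriv.mul_left (f := fun r : ℝ => r)
    ).exists_bound_of_continuous (by fun_prop)
  have hA0 : 0 ≤ A := (norm_nonneg _).trans (hA 0)
  set H : ℝ → ℝ := fun r => -deriv α r * (r ^ n)⁻¹ + (1 - α r) * (-(n * r ^ (n - 1)) / (r ^ n) ^ 2)
  set M : ℝ := A + (1 + B) * n
  have hM0 : 0 ≤ M := by positivity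
  have hH : ∀ r ∈ Ioi δ, |H r| ≤ M * r ^ (-(n + 1 : ℝ)) := by
    intro r hr
    have hr0 : 0 < r := hδ.trans hr
    have e1 : r ^ (-(n + 1 : ℝ)) = (r ^ (n + 1))⁻¹ := by
      rw [Real.rpow_neg hr0.le]; norm_cast
    have e2 : H r = (-(r * deriv α r) - (1 - α r) * n) * (r ^ (n + 1))⁻¹ := by
      obtain ⟨m, rfl⟩ : ∃ m, n = m + 1 := ⟨n - 1, by omega⟩
      simp only [H, Nat.add_sub_cancel]
      field_simp
      ring
    rw [e1, e2, abs_mul, abs_of_pos (a := (r ^ (n + 1))⁻¹) (by positivity)]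
    gcongr
    have h1 : |r * deriv α r| ≤ A := hA r
    have h2 : |1 - α r| ≤ 1 + B := (abs_sub _ _).trans (by simpa using hB r)
    calc |-(r * deriv α r) - (1 - α r) * n| ≤ |-(r * deriv α r)| + |(1 - α r) * n| := abs_sub _ _
      _ ≤ A + (1 + B) * n := by
        rw [abs_neg, abs_mul (1 - α r), Nat.abs_cast]; gcongr
  have hint : IntegrableOn (fun r : ℝ => M * r ^ (-(n + 1 : ℝ))) (Ioi δ) := by
    refine (integrableOn_Ioi_rpow_of_lt ?_ hδ).const_mul M
    have : (1 : ℝ) ≤ n := by exact_mod_cast hn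
    linarith
  refine ⟨∫ r in Ioi δ, M * r ^ (-(n + 1 : ℝ)), setIntegral_nonneg measurableSet_Ioi
    (fun r hr => mul_nonneg hM0 (Real.rpow_nonneg (hδ.trans hr).le _)), fun ρ hρ => ?_⟩
  have hρ0 : ρ ≠ 0 := by rintro rfl; simp at hρ
  set E : ℝ → ℂ := fun r => Complex.exp (-ρ * r ^ (n + 1))
  have hE : ∀ r, HasDerivAt E (E r * (-ρ * ((n + 1) * r ^ n))) r := by
    intro r
    have h1 : HasDerivAt (fun r : ℝ => ((r ^ (n + 1) : ℝ) : ℂ)) (((n + 1) * r ^ n : ℝ) : ℂ) r := by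
      simpa using (hasDerivAt_pow (n + 1) r).ofReal_comp
    simpa [E] using (h1.const_mul (-ρ)).cexp
  have hG : ∀ r, 0 < r → HasDerivAt (fun r => (1 - α r) * (r ^ n)⁻¹) (H r) r := by
    intro r hr
    have h1 := (hdiff r).hasDerivAt.const_sub 1
    have h2 := (hasDerivAt_pow n r).fun_inv (by positivity)
    exact h1.mul h2
  have hf : ∀ r, 0 < r → HasDerivAt (fun r => (((1 - α r) * (r ^ n)⁻¹ : ℝ) : ℂ) * E r)
      (H r * E r - ρ * (n + 1) * (((1 - α r : ℝ) : ℂ) * E r)) r := by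
    intro r hr
    refine ((hG r hr).ofReal_comp.mul (hE r)).congr_deriv ?_
    have : (r : ℂ) ^ n ≠ 0 := by exact_mod_cast (pow_pos hr n).ne'
    push_cast
    linear_combination (-ρ * (n + 1) * (1 - α r) * E r) * inv_mul_cancel₀ this
  have hEle : ∀ r ∈ Ioi δ, ‖E r‖ ≤ 1 := fun r hr =>
    norm_cexp_neg_mul_pow_le_one hρ.le (hδ.trans hr).le _
  have hHmeas : Measurable H := by
    have := hcont'.measurable
    have := hα.contDiff.continuous.measurable
    fun_prop
  have hI1 : IntegrableOn (fun r => (H r : ℂ) * E r) (Ioi δ) := by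
    refine Integrable.mono' hint ?_ ?_
    · exact ((Complex.measurable_ofReal.comp hHmeas).mul (by fun_prop)).aestronglyMeasurable
    · filter_upwards [ae_restrict_mem measurableSet_Ioi] with r hr
      rw [norm_mul, Complex.norm_real, Real.norm_eq_abs]
      calc |H r| * ‖E r‖ ≤ |H r| * 1 := by gcongr; exact hEle r hr
        _ ≤ _ := by rw [mul_one]; exact hH r hr
  have hI2 : IntegrableOn (fun r => ((1 - α r : ℝ) : ℂ) * E r) (Ioi δ) := by
    have h0 := (integrableOn_cexp_neg_mul_pow (p := n + 1) (by omega) hρ).mono_set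
      (Ioi_subset_Ioi hδ.le)
    refine Integrable.bdd_mul h0 (c := 1 + B) ?_ (Eventually.of_forall fun r => ?_)
    · have := hα.contDiff.continuous
      exact Continuous.aestronglyMeasurable (by fun_prop)
    · rw [Complex.norm_real, Real.norm_eq_abs]
      exact (abs_sub _ _).trans (by simpa using hB r)
  have hlim : Tendsto (fun r => (((1 - α r) * (r ^ n)⁻¹ : ℝ) : ℂ) * E r) atTop (𝓝 0) := by
    have h1 : Tendsto (fun r : ℝ => (1 + B) * (r ^ n)⁻¹) atTop (𝓝 0) := by
      simpa using (tendsto_pow_atTop (by omega : n ≠ 0)).inv_tendsto_atTop.const_mul (1 + B)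
    refine squeeze_zero_norm' ?_ h1
    filter_upwards [eventually_gt_atTop δ] with r hr
    have hr0 : 0 < r := hδ.trans hr
    rw [norm_mul, Complex.norm_real, norm_mul, Real.norm_eq_abs, Real.norm_eq_abs,
      abs_of_pos (a := (r ^ n)⁻¹) (by positivity)]
    have h2 : |1 - α r| ≤ 1 + B := (abs_sub _ _).trans (by simpa using hB r)
    calc |1 - α r| * (r ^ n)⁻¹ * ‖E r‖ ≤ (1 + B) * (r ^ n)⁻¹ * 1 := by
          gcongr; exact hEle r hr
      _ = _ := mul_one _
  -- The boundary term at `δ` vanishes because `α δ = 1`, the one at infinity by `hlim`.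
  have key := integral_Ioi_of_hasDerivAt_of_tendsto'
    (fun r hr => hf r (hδ.trans_le hr)) (hI1.sub (hI2.const_mul _)) hlim
  rw [integral_sub hI1 (hI2.const_mul _), integral_const_mul, hone' δ hδ le_rfl] at key
  simp only [sub_self, zero_mul, Complex.ofReal_zero] at key
  have hset : ∫ r in Ioi (0 : ℝ), ((1 - α r : ℝ) : ℂ) * E r =
      ∫ r in Ioi δ, ((1 - α r : ℝ) : ℂ) * E r := by
    refine setIntegral_eq_of_subset_of_forall_sdiff_eq_zero measurableSet_Ioi
      (Ioi_subset_Ioi hδ.le) (fun r hr => ?_)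
    rw [hone' r hr.1 (not_lt.1 hr.2)]; simp
  have hle : ‖∫ r in Ioi δ, (H r : ℂ) * E r‖ ≤ ∫ r in Ioi δ, M * r ^ (-(n + 1 : ℝ)) := by
    refine norm_integral_le_of_norm_le hint ?_
    filter_upwards [ae_restrict_mem measurableSet_Ioi] with r hr
    rw [norm_mul, Complex.norm_real, Real.norm_eq_abs]
    calc |H r| * ‖E r‖ ≤ |H r| * 1 := by gcongr; exact hEle r hr
      _ ≤ _ := by rw [mul_one]; exact hH r hr
  rw [hset, le_div_iff₀ (norm_pos_iff.2 hρ0)]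
  rw [sub_eq_zero.1 key, norm_mul, norm_mul] at hle
  have hn1 : (1 : ℝ) ≤ ‖(n + 1 : ℂ)‖ := by
    have : ‖(n + 1 : ℂ)‖ = n + 1 := by exact_mod_cast Complex.norm_natCast (n + 1)
    rw [this]; linarith [(n : ℕ).cast_nonneg (α := ℝ)]
  refine le_trans ?_ hle
  have : 0 ≤ ‖ρ‖ * ‖∫ r in Ioi δ, ((1 - α r : ℝ) : ℂ) * E r‖ := by positivity
  nlinarith

/-! ### Truncated Fresnel integrals -/

open Set in
/-- The truncated Fresnel-type integral `∫₀^∞ α(r) exp (i μ r ^ p) dr`. -/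
noncomputable def cutoffFresnel (p : ℕ) (α : ℝ → ℝ) (μ : ℝ) : ℂ :=
  ∫ r in Ioi (0 : ℝ), (α r : ℂ) * Complex.exp (Complex.I * μ * r ^ p)

/-- The value `Γ(1 / p + 1) (i / μ) ^ (1 / p)` of the conditionally convergent integral
`∫₀^∞ exp (i μ r ^ p) dr`. -/
noncomputable def fresnel (p : ℕ) (μ : ℝ) : ℂ :=
  Real.Gamma (1 / p + 1) * (Complex.I / μ) ^ (1 / p : ℂ)

theorem norm_fresnel {p : ℕ} (μ : ℝ) :
    ‖fresnel p μ‖ = Real.Gamma (1 / p + 1) * |μ| ^ (-(1 / p : ℝ)) := by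
  have h : ‖(Complex.I / μ) ^ (1 / p : ℂ)‖ = |μ| ^ (-(1 / p : ℝ)) := by
    have := Complex.norm_cpow_real (Complex.I / μ) (1 / p : ℝ)
    push_cast at this
    rw [this, norm_div, Complex.norm_I, Complex.norm_real, Real.norm_eq_abs, one_div |μ|,
      Real.inv_rpow (abs_nonneg _), Real.rpow_neg (abs_nonneg _)]
  have hG : 0 < Real.Gamma (1 / p + 1) := Real.Gamma_pos_of_pos (by positivity)
  rw [fresnel, norm_mul, h, Complex.norm_real, Real.norm_of_nonneg hG.le]

/-- Homogeneity of degree `-1 / p`. At `μ = 0` both sides are `0` for `p ≠ 0`, by the conventions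
for division by zero and powers of zero. -/
theorem fresnel_mul {p : ℕ} {t : ℝ} (ht : 0 < t) (μ : ℝ) :
    fresnel p (t * μ) = ((t ^ (-(1 / p : ℝ)) : ℝ) : ℂ) * fresnel p μ := by
  have h : (Complex.I / (t * μ : ℝ)) ^ (1 / p : ℂ) =
      ((t ^ (-(1 / p : ℝ)) : ℝ) : ℂ) * (Complex.I / μ) ^ (1 / p : ℂ) := by
    have e : Complex.I / (t * μ : ℝ) = ((t⁻¹ : ℝ) : ℂ) * (Complex.I / μ) := by
      push_cast; field_simp
    have e2 : ((t ^ (-(1 / p : ℝ)) : ℝ) : ℂ) = ((t⁻¹ : ℝ) : ℂ) ^ (1 / p : ℂ) := by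
      rw [Real.rpow_neg ht.le, ← Real.inv_rpow ht.le, Complex.ofReal_cpow (by positivity)]
      push_cast; rfl
    have ht' : ((t⁻¹ : ℝ) : ℂ) ≠ 0 := by exact_mod_cast (inv_pos.2 ht).ne'
    rcases eq_or_ne μ 0 with rfl | hμ
    · rcases eq_or_ne p 0 with rfl | hp
      · simp
      · have : (1 / p : ℂ) ≠ 0 := by simpa using hp
        simp [hp]
    · have hz : Complex.I / (μ : ℂ) ≠ 0 := div_ne_zero Complex.I_ne_zero (by exact_mod_cast hμ)
      rw [e, e2, Complex.cpow_def_of_ne_zero (mul_ne_zero ht' hz), Complex.cpow_def_of_ne_zero ht',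
        Complex.cpow_def_of_ne_zero hz, Complex.log_ofReal_mul (inv_pos.2 ht) hz,
        ← Complex.exp_add, Complex.ofReal_log (inv_pos.2 ht).le]
      ring_nf
  rw [fresnel, h, fresnel]
  ring

theorem fresnel_ne_zero {p : ℕ} {μ : ℝ} (hμ : μ ≠ 0) : fresnel p μ ≠ 0 := by
  rw [← norm_pos_iff, norm_fresnel]
  have hG : 0 < Real.Gamma (1 / p + 1) := Real.Gamma_pos_of_pos (by positivity)
  have := abs_pos.2 hμ
  positivity

theorem measurable_fresnel (p : ℕ) : Measurable (fresnel p) := by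
  unfold fresnel
  fun_prop

open Set in
theorem norm_cutoffFresnel_le {α : ℝ → ℝ} (p : ℕ) (μ : ℝ) :
    ‖cutoffFresnel p α μ‖ ≤ ∫ r in Ioi (0 : ℝ), |α r| := by
  refine (norm_integral_le_integral_norm _).trans_eq ?_
  refine integral_congr_ae (Eventually.of_forall fun r => ?_)
  simp only [norm_mul, Complex.norm_real, Real.norm_eq_abs]
  have : Complex.I * μ * (r : ℂ) ^ p = ((μ * r ^ p : ℝ) : ℂ) * Complex.I := by push_cast; ring
  rw [this, Complex.norm_exp_ofReal_mul_I, mul_one]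

open Set in
/-- The limit of the damped integrals as the damping tends to `0`: on the full half-line it is
`fresnel p μ`, and the part cut off by `1 - α` stays `O(1 / |μ|)`. -/
theorem IsCutoff.exists_norm_sub_fresnel_le {α : ℝ → ℝ} (hα : IsCutoff α) {p : ℕ} (hp : 2 ≤ p) :
    ∃ C, 0 ≤ C ∧ ∀ μ : ℝ, μ ≠ 0 → ‖cutoffFresnel p α μ - fresnel p μ‖ ≤ C / |μ| := by
  obtain ⟨C, hC, h⟩ := hα.exists_norm_integral_one_sub_le hp
  have hαint : Integrable (fun r => (α r : ℂ)) :=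
    (hα.contDiff.continuous.integrable_of_hasCompactSupport hα.hasCompactSupport).ofReal
  refine ⟨C, hC, fun μ hμ => ?_⟩
  -- The damping is the real part `ε` of `ρ ε`, and `|μ| ≤ ‖ρ ε‖` bounds the tail uniformly in `ε`.
  set ρ : ℝ → ℂ := fun ε => ε - Complex.I * μ
  have hρre : ∀ ε, (ρ ε).re = ε := fun ε => by simp [ρ]
  have hρim : ∀ ε, (ρ ε).im = -μ := fun ε => by simp [ρ]
  have hρc : Continuous ρ := by fun_prop
  have hρ0 : ρ 0 ≠ 0 := fun h0 => hμ (by simpa [hρim] using congrArg Complex.im h0)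
  have h1 : Tendsto (fun ε => ∫ r in Ioi (0 : ℝ), (α r : ℂ) * Complex.exp (-ρ ε * r ^ p))
      (𝓝[>] 0) (𝓝 (cutoffFresnel p α μ)) := by
    have e : cutoffFresnel p α μ =
        ∫ r in Ioi (0 : ℝ), (α r : ℂ) * Complex.exp (-ρ 0 * r ^ p) := by simp [cutoffFresnel, ρ]
    rw [e]
    have hc := hα.contDiff.continuous
    refine tendsto_integral_filter_of_dominated_convergence (fun r => ‖(α r : ℂ)‖)
      (Eventually.of_forall fun ε => Continuous.aestronglyMeasurable (by fun_prop)) ?_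
      hαint.norm.integrableOn (Eventually.of_forall fun r => ?_)
    · filter_upwards [self_mem_nhdsWithin] with ε hε
      filter_upwards [ae_restrict_mem measurableSet_Ioi] with r hr
      rw [norm_mul]
      refine mul_le_of_le_one_right (norm_nonneg _) (norm_cexp_neg_mul_pow_le_one ?_ (le_of_lt hr) p)
      rw [hρre]; exact le_of_lt hε
    · refine (Continuous.tendsto (by fun_prop) 0).mono_left nhdsWithin_le_nhds
  have h2 : Tendsto (fun ε => (Real.Gamma (1 / p + 1) : ℂ) * (1 / ρ ε) ^ (1 / p : ℂ))
      (𝓝[>] 0) (𝓝 (fresnel p μ)) := by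
    have e : Complex.I / μ = 1 / ρ 0 := by
      have : (μ : ℂ) ≠ 0 := by exact_mod_cast hμ
      simp only [ρ]
      field_simp
      simp
      linear_combination (-(μ : ℂ)) * Complex.I_mul_I
    rw [fresnel, e]
    refine Tendsto.const_mul _ (ContinuousAt.tendsto (f := fun ε => (1 / ρ ε) ^ (1 / p : ℂ))
      (ContinuousAt.cpow (continuousAt_const.div hρc.continuousAt hρ0) continuousAt_const ?_)
      |>.mono_left nhdsWithin_le_nhds)
    right
    rw [one_div, Complex.inv_im, hρim, neg_neg]
    exact div_ne_zero hμ (Complex.normSq_pos.2 hρ0).ne'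
  refine le_of_tendsto (h1.sub h2).norm ?_
  filter_upwards [self_mem_nhdsWithin] with ε hε
  have hre : 0 < (ρ ε).re := by rw [hρre]; exact hε
  have hEint := integrableOn_cexp_neg_mul_pow (p := p) (by omega) hre
  have hαE : IntegrableOn (fun r : ℝ => (α r : ℂ) * Complex.exp (-ρ ε * r ^ p)) (Ioi 0) := by
    obtain ⟨B, hB0, hB⟩ := hα.exists_abs_le
    have hc := hα.contDiff.continuous
    refine Integrable.bdd_mul hEint (c := B) (Continuous.aestronglyMeasurable (by fun_prop))
      (Eventually.of_forall fun r => ?_)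
    simpa using hB r
  rw [← integral_cexp_neg_mul_pow (by omega) hre, ← integral_sub hαE hEint, ← norm_neg,
    ← integral_neg]
  have hle : C / ‖ρ ε‖ ≤ C / |μ| := by
    refine div_le_div_of_nonneg_left hC (abs_pos.2 hμ) ?_
    simpa [hρim] using Complex.abs_im_le_norm (ρ ε)
  refine le_trans (le_of_eq ?_) ((h (ρ ε) hre).trans hle)
  congr 1
  refine integral_congr_ae (Eventually.of_forall fun r => ?_)
  push_cast
  ring

/-- The trivial bound for small `μ` and the integration by parts for large `μ` combine into a power
bound for every intermediate exponent, with a constant independent of that exponent. -/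
theorem IsCutoff.exists_norm_sub_fresnel_le_rpow {α : ℝ → ℝ} (hα : IsCutoff α) {p : ℕ}
    (hp : 2 ≤ p) :
    ∃ C, 0 ≤ C ∧ ∀ μ : ℝ, μ ≠ 0 → ∀ s : ℝ, 1 / p ≤ s → s ≤ 1 →
      ‖cutoffFresnel p α μ - fresnel p μ‖ ≤ C * |μ| ^ (-s) := by
  obtain ⟨C, hC, h⟩ := hα.exists_norm_sub_fresnel_le hp
  set D := ∫ r in Set.Ioi (0 : ℝ), |α r|
  have hD : 0 ≤ D := integral_nonneg fun _ => abs_nonneg _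
  set G := Real.Gamma (1 / p + 1)
  have hG : 0 < G := Real.Gamma_pos_of_pos (by positivity)
  refine ⟨C + D + G, by positivity, fun μ hμ s hs hs1 => ?_⟩
  have hμ' := abs_pos.2 hμ
  rcases le_total 1 |μ| with h1 | h1
  · calc _ ≤ C / |μ| := h μ hμ
      _ = C * |μ| ^ (-1 : ℝ) := by rw [Real.rpow_neg_one]; rfl
      _ ≤ (C + D + G) * |μ| ^ (-s) := by
        gcongr
        · linarith
  · have hs0 : |μ| ^ (-(1 / p : ℝ)) ≤ |μ| ^ (-s) :=
      Real.rpow_le_rpow_of_exponent_ge hμ' h1 (by linarith)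
    have hp0 : (0 : ℝ) ≤ 1 / p := by positivity
    have hs2 : 1 ≤ |μ| ^ (-s) := Real.one_le_rpow_of_pos_of_le_one_of_nonpos hμ' h1 (by linarith)
    calc _ ≤ ‖cutoffFresnel p α μ‖ + ‖fresnel p μ‖ := norm_sub_le _ _
      _ ≤ D * 1 + G * |μ| ^ (-(1 / p : ℝ)) := by
        rw [norm_fresnel, mul_one]
        gcongr
        exact norm_cutoffFresnel_le p μ
      _ ≤ D * |μ| ^ (-s) + G * |μ| ^ (-s) := by gcongr
      _ ≤ (C + D + G) * |μ| ^ (-s) := by nlinarith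

/-! ### Integrable singularities on the circle -/

open Real Set in
/-- A continuous function of the angle that vanishes so mildly that `|f| ^ (-1/2)` is integrable
over a period. -/
structure HasMildZeros (f : ℝ → ℝ) : Prop where
  continuous : Continuous f
  ae_ne_zero : ∀ᵐ θ : ℝ, f θ ≠ 0
  integrableOn : IntegrableOn (fun θ => |f θ| ^ (-(1 / 2) : ℝ)) (Ioo (-π) π)

open Real Set in
/-- On a half period around `0` the bound `|sin θ| ≥ (2 / π) |θ|` applies; periodicity gives every
other interval. -/
theorem intervalIntegrable_abs_sin_rpow (a b : ℝ) :
    IntervalIntegrable (fun θ => |sin θ| ^ (-(1 / 2) : ℝ)) volume a b := by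
  have hper : Function.Periodic (fun θ => |sin θ| ^ (-(1 / 2) : ℝ)) π := fun θ => by
    simp [sin_add_pi]
  refine hper.intervalIntegrable pi_ne_zero (t := -(π / 2)) ?_ a b
  have hb : -(π / 2) + π = π / 2 := by ring
  rw [hb]
  have h1 : IntervalIntegrable (fun θ : ℝ => (2 / π) ^ (-(1 / 2) : ℝ) * |θ| ^ (-(1 / 2) : ℝ)) volume
      (-(π / 2)) (π / 2) := by
    have h0 : ∀ c : ℝ, 0 ≤ c →
        IntervalIntegrable (fun θ : ℝ => |θ| ^ (-(1 / 2) : ℝ)) volume 0 c := by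
      intro c hc
      refine (intervalIntegral.intervalIntegrable_rpow' (r := -(1 / 2)) (by norm_num)).congr ?_
      intro θ hθ
      rw [uIoc_of_le hc] at hθ
      simp only [abs_of_pos hθ.1]
    have h2 := h0 (π / 2) (by positivity)
    have h3 := (h2.comp_sub_left 0)
    simp only [zero_sub, abs_neg, sub_self] at h3
    exact ((h3.symm).trans (by simpa using h2)).const_mul _
  refine h1.mono_fun' (Measurable.aestronglyMeasurable (by fun_prop)) ?_
  rw [uIoc_of_le (by linarith [pi_pos])]
  filter_upwards [ae_restrict_mem measurableSet_Ioc] with θ hθ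
  rw [norm_of_nonneg (by positivity), ← mul_rpow (by positivity) (by positivity)]
  rcases eq_or_ne θ 0 with rfl | h0
  · simp
  · refine rpow_le_rpow_of_nonpos (by positivity) (mul_abs_le_abs_sin ?_) (by norm_num)
    exact abs_le.2 ⟨hθ.1.le, hθ.2⟩

open Real Set in
/-- Nonzero linear forms on the circle have simple zeros. -/
theorem hasMildZeros_linear {a b : ℝ} (h : a ≠ 0 ∨ b ≠ 0) :
    HasMildZeros (fun θ => a * cos θ + b * sin θ) := by
  set z : ℂ := ⟨b, a⟩
  have hz : z ≠ 0 := by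
    intro h0
    have h1 := congrArg Complex.re h0
    have h2 := congrArg Complex.im h0
    simp [z] at h1 h2
    tauto
  have hR := norm_pos_iff.2 hz
  have hf : ∀ θ, a * cos θ + b * sin θ = ‖z‖ * sin (θ + z.arg) := by
    intro θ
    have h1 : ‖z‖ * cos z.arg = b := Complex.norm_mul_cos_arg z
    have h2 : ‖z‖ * sin z.arg = a := Complex.norm_mul_sin_arg z
    rw [sin_add, ← h1, ← h2]; ring
  refine ⟨by fun_prop, ?_, ?_⟩
  · have hc : ({θ | a * cos θ + b * sin θ = 0} : Set ℝ).Countable := by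
      refine (countable_range fun n : ℤ => n * π - z.arg).mono fun θ hθ => ?_
      have h1 : ‖z‖ * sin (θ + z.arg) = 0 := (hf θ).symm.trans hθ
      obtain ⟨n, hn⟩ := sin_eq_zero_iff.1 ((mul_eq_zero.1 h1).resolve_left hR.ne')
      exact ⟨n, by simp only [hn]; ring⟩
    exact hc.ae_notMem volume
  · simp only [hf]
    have h1 := (intervalIntegrable_abs_sin_rpow (-π + z.arg) (π + z.arg)).comp_add_right z.arg
    simp only [add_sub_cancel_right] at h1
    have h2 := (h1.const_mul (‖z‖ ^ (-(1 / 2) : ℝ)))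
    rw [intervalIntegrable_iff_integrableOn_Ioo_of_le (by linarith [pi_pos])] at h2
    refine h2.congr (Eventually.of_forall fun θ => ?_)
    simp only [abs_mul, abs_norm]
    rw [mul_rpow (norm_nonneg _) (abs_nonneg _)]

open Real Set in
/-- If `f` and `g` have no common zero, then at every point one of them is bounded below, so that
`|f g| ^ (-1/2)` is controlled by `|f| ^ (-1/2) + |g| ^ (-1/2)`. -/
theorem HasMildZeros.mul {f g : ℝ → ℝ} (hf : HasMildZeros f) (hg : HasMildZeros g)
    (h : ∀ θ, f θ = 0 → g θ ≠ 0) : HasMildZeros (fun θ => f θ * g θ) := by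
  have hfc := hf.continuous
  have hgc := hg.continuous
  refine ⟨by fun_prop, ?_, ?_⟩
  · filter_upwards [hf.ae_ne_zero, hg.ae_ne_zero] with θ h1 h2 using mul_ne_zero h1 h2
  · obtain ⟨x, -, hx⟩ := (isCompact_Icc (a := -π) (b := π)).exists_isMinOn
      ⟨0, by constructor <;> linarith [pi_pos]⟩
      (f := fun θ => max |f θ| |g θ|) (by fun_prop)
    set δ := max |f x| |g x|
    have hδ : 0 < δ := by
      rcases eq_or_ne (f x) 0 with h0 | h0
      · exact lt_max_of_lt_right (abs_pos.2 (h x h0))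
      · exact lt_max_of_lt_left (abs_pos.2 h0)
    refine Integrable.mono' ((hf.integrableOn.add hg.integrableOn).const_mul (δ ^ (-(1 / 2) : ℝ)))
      (Measurable.aestronglyMeasurable ?_) ?_
    · have := hfc.measurable
      have := hgc.measurable
      fun_prop
    · filter_upwards [ae_restrict_mem measurableSet_Ioo] with θ hθ
      have hmin : δ ≤ max |f θ| |g θ| := hx (Ioo_subset_Icc_self hθ)
      rw [norm_of_nonneg (by positivity), abs_mul, mul_rpow (abs_nonneg _) (abs_nonneg _),
        Pi.add_apply]
      have hF : 0 ≤ |f θ| ^ (-(1 / 2) : ℝ) := by positivity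
      have hG : 0 ≤ |g θ| ^ (-(1 / 2) : ℝ) := by positivity
      have hD : 0 ≤ δ ^ (-(1 / 2) : ℝ) := by positivity
      rcases le_max_iff.1 hmin with h1 | h1
      · have := rpow_le_rpow_of_nonpos hδ h1 (z := -(1 / 2)) (by norm_num)
        nlinarith [mul_le_mul_of_nonneg_right this hG, mul_nonneg hD hF]
      · have := rpow_le_rpow_of_nonpos hδ h1 (z := -(1 / 2)) (by norm_num)
        nlinarith [mul_le_mul_of_nonneg_right this hF, mul_nonneg hD hG]

/-- The binary cubic form that the cubic `cubicP4` induces on the sums `u = ξ₁ + ξ₂` and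
`w = ξ₃ + ξ₄`. -/
noncomputable def sumCubic (u w : ℝ) : ℝ := 3 / 4 * ((u + w) * (u ^ 2 + 3 * u * w + w ^ 2))

open Real in
theorem hasMildZeros_cos_mul_sin : HasMildZeros (fun θ => cos θ * sin θ) := by
  have h1 := hasMildZeros_linear (a := 1) (b := 0) (by simp)
  have h2 := hasMildZeros_linear (a := 0) (b := 1) (by simp)
  simp only [one_mul, zero_mul, add_zero, zero_add] at h1 h2
  refine h1.mul h2 fun θ hc hs => ?_
  have := sin_sq_add_cos_sq θ
  simp [hc, hs] at this

open Real in
/-- The five real linear factors of `u w Q(u, w)`, with `Q = sumCubic`, are pairwise independent. -/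
theorem hasMildZeros_cos_mul_sin_mul_sumCubic :
    HasMildZeros (fun θ => cos θ * sin θ * sumCubic (cos θ) (sin θ)) := by
  have h5 : √5 ^ 2 = 5 := sq_sqrt (by norm_num)
  have h3 := hasMildZeros_linear (a := 3 / 4) (b := 3 / 4) (by norm_num)
  have h4 := hasMildZeros_linear (a := 1) (b := (3 + √5) / 2) (by norm_num)
  have h6 := hasMildZeros_linear (a := 1) (b := (3 - √5) / 2) (by norm_num)
  -- The two real factors of `u² + 3 u w + w²`.
  have hq : ∀ θ, (1 * cos θ + (3 + √5) / 2 * sin θ) * (1 * cos θ + (3 - √5) / 2 * sin θ) =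
      cos θ ^ 2 + 3 * cos θ * sin θ + sin θ ^ 2 := fun θ => by
    linear_combination (-(sin θ ^ 2) / 4) * h5
  have h46 := h4.mul h6 fun θ h1 h2 => by
    have e1 : √5 * sin θ = 0 := by linear_combination h1 - h2
    have hs : sin θ = 0 := (mul_eq_zero.1 e1).resolve_left (by positivity)
    have := sin_sq_add_cos_sq θ
    simp [hs] at h1
    simp [hs, h1] at this
  simp only [hq] at h46
  have h346 := h3.mul h46 fun θ h1 h2 => by
    have := sin_sq_add_cos_sq θ
    have hc : cos θ = -sin θ := by linarith
    rw [hc] at this h2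
    nlinarith
  have := hasMildZeros_cos_mul_sin.mul h346 fun θ h1 h2 => by
    have := sin_sq_add_cos_sq θ
    rcases mul_eq_zero.1 h1 with h0 | h0 <;> rw [h0] at this h2
    · have : sin θ ^ 3 = 0 := by linarith
      simp [pow_eq_zero_iff] at this
      simp_all
    · have : cos θ ^ 3 = 0 := by linarith
      simp [pow_eq_zero_iff] at this
      simp_all
  convert this using 2 with θ
  rw [sumCubic]; ring

/-! ### The leading coefficient -/

theorem sumCubic_mul_mul (r u w : ℝ) : sumCubic (r * u) (r * w) = r ^ 3 * sumCubic u w := by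
  unfold sumCubic; ring

open Real Set in
/-- The angular density left after the two quadratic variables and the radius are separated off. -/
noncomputable def angularDensity (θ : ℝ) : ℂ :=
  fresnel 2 (-(3 / 4) * cos θ) * fresnel 2 (-(3 / 4) * sin θ)

open Real Set in
/-- The coefficient of the leading term of the oscillatory integral with phase `cubicP4`, up to
a nonzero real factor. -/
noncomputable def leadingCoeff : ℂ :=
  ∫ θ in Ioo (-π) π, angularDensity θ * fresnel 3 (sumCubic (cos θ) (sin θ))

open Real in
theorem norm_angularDensity (θ : ℝ) :
    ‖angularDensity θ‖ = Real.Gamma (1 / (2 : ℕ) + 1) ^ 2 * (3 / 4) ^ (-1 : ℝ) *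
      |cos θ * sin θ| ^ (-(1 / 2) : ℝ) := by
  have h : (3 / 4 : ℝ) ^ (-1 : ℝ) = (3 / 4 : ℝ) ^ (-(1 / 2) : ℝ) * (3 / 4 : ℝ) ^ (-(1 / 2) : ℝ) := by
    rw [← rpow_add (by norm_num)]; norm_num
  rw [angularDensity, norm_mul, norm_fresnel, norm_fresnel, abs_mul, abs_mul, abs_neg,
    abs_of_pos (a := (3 / 4 : ℝ)) (by norm_num), abs_mul,
    mul_rpow (by norm_num) (abs_nonneg _), mul_rpow (by norm_num) (abs_nonneg _),
    mul_rpow (abs_nonneg _) (abs_nonneg _), h]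
  push_cast
  ring

theorem measurable_angularDensity : Measurable angularDensity := by
  have := measurable_fresnel 2
  unfold angularDensity
  fun_prop

open Real Set in
theorem integrableOn_angularDensity : IntegrableOn angularDensity (Ioo (-π) π) := by
  refine Integrable.mono' (hasMildZeros_cos_mul_sin.integrableOn.const_mul
    (Real.Gamma (1 / (2 : ℕ) + 1) ^ 2 * (3 / 4) ^ (-1 : ℝ)))
    measurable_angularDensity.aestronglyMeasurable (Eventually.of_forall fun θ => ?_)
  rw [norm_angularDensity]

open Real Set in
theorem integrableOn_norm_angularDensity_mul_rpow :
    IntegrableOn (fun θ => ‖angularDensity θ‖ * |sumCubic (cos θ) (sin θ)| ^ (-(1 / 2) : ℝ))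
      (Ioo (-π) π) := by
  refine (hasMildZeros_cos_mul_sin_mul_sumCubic.integrableOn.const_mul
    (Real.Gamma (1 / (2 : ℕ) + 1) ^ 2 * (3 / 4) ^ (-1 : ℝ))).congr
    (Eventually.of_forall fun θ => ?_)
  simp only
  rw [norm_angularDensity, abs_mul, mul_rpow (abs_nonneg _) (abs_nonneg _)]
  ring

open Real in
theorem abs_sumCubic_cos_sin_le (θ : ℝ) : |sumCubic (cos θ) (sin θ)| ≤ 6 := by
  have h := sin_sq_add_cos_sq θ
  have hc := abs_cos_le_one θ
  have hs := abs_sin_le_one θ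
  have h1 : |cos θ + sin θ| ≤ 2 := (abs_add_le _ _).trans (by linarith)
  have h2 : |cos θ ^ 2 + 3 * cos θ * sin θ + sin θ ^ 2| ≤ 4 := by
    have e : cos θ ^ 2 + 3 * cos θ * sin θ + sin θ ^ 2 = 1 + 3 * (cos θ * sin θ) := by linarith
    have h3 : |cos θ * sin θ| ≤ 1 := by
      rw [abs_mul]; exact mul_le_one₀ hc (abs_nonneg _) hs
    rw [e]
    rw [abs_le] at h3 ⊢
    constructor <;> linarith [h3.1, h3.2]
  rw [sumCubic, abs_mul, abs_mul, abs_of_pos (a := (3 / 4 : ℝ)) (by norm_num)]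
  nlinarith [mul_le_mul h1 h2 (abs_nonneg _) (by norm_num : (0 : ℝ) ≤ 2)]

open Real Set in
theorem ae_cos_mul_sin_mul_sumCubic_ne_zero :
    ∀ᵐ θ ∂(volume.restrict (Ioo (-π) π)), cos θ * sin θ * sumCubic (cos θ) (sin θ) ≠ 0 :=
  ae_restrict_of_ae hasMildZeros_cos_mul_sin_mul_sumCubic.ae_ne_zero

open Real Set in
theorem integrableOn_angularDensity_mul_fresnel :
    IntegrableOn (fun θ => angularDensity θ * fresnel 3 (sumCubic (cos θ) (sin θ)))
      (Ioo (-π) π) := by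
  have hm := measurable_fresnel 3
  have hG : 0 < Real.Gamma (1 / (3 : ℕ) + 1) := Real.Gamma_pos_of_pos (by positivity)
  refine Integrable.mono' (integrableOn_norm_angularDensity_mul_rpow.const_mul
    (Real.Gamma (1 / (3 : ℕ) + 1) * 6 ^ (1 / 6 : ℝ)))
    (measurable_angularDensity.mul (hm.comp (by unfold sumCubic; fun_prop))).aestronglyMeasurable ?_
  filter_upwards [ae_cos_mul_sin_mul_sumCubic_ne_zero] with θ hθ
  have hq : 0 < |sumCubic (cos θ) (sin θ)| := abs_pos.2 (right_ne_zero_of_mul hθ)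
  set q := |sumCubic (cos θ) (sin θ)|
  have h1 : q ^ (-(1 / (3 : ℕ)) : ℝ) ≤ 6 ^ (1 / 6 : ℝ) * q ^ (-(1 / 2) : ℝ) := by
    calc q ^ (-(1 / (3 : ℕ)) : ℝ) = q ^ (1 / 6 : ℝ) * q ^ (-(1 / 2) : ℝ) := by
          rw [← rpow_add hq]; norm_num
      _ ≤ _ := by gcongr; exact abs_sumCubic_cos_sin_le θ
  rw [norm_mul, norm_fresnel]
  calc ‖angularDensity θ‖ * (Real.Gamma (1 / (3 : ℕ) + 1) * q ^ (-(1 / (3 : ℕ)) : ℝ))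
      ≤ ‖angularDensity θ‖ * (Real.Gamma (1 / (3 : ℕ) + 1) *
        (6 ^ (1 / 6 : ℝ) * q ^ (-(1 / 2) : ℝ))) := by gcongr
    _ = _ := by ring

theorem log_I_div_im {x : ℝ} (hx : x ≠ 0) :
    (Complex.log (Complex.I / x)).im = SignType.sign x * (Real.pi / 2) := by
  have e : Complex.I / (x : ℂ) = ((x⁻¹ : ℝ) : ℂ) * Complex.I := by push_cast; field_simp
  have e' : Complex.I / (x : ℂ) = ((-x⁻¹ : ℝ) : ℂ) * -Complex.I := by push_cast; field_simp
  rw [Complex.log_im]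
  rcases lt_or_gt_of_ne hx with h | h
  · rw [e', Complex.arg_real_mul _ (by simpa using h), Complex.arg_neg_I, sign_neg h]
    simp
  · rw [e, Complex.arg_real_mul _ (by simpa using h), Complex.arg_I, sign_pos h]
    simp

open Real in
/-- The total argument `(ε₁ + ε₂) π / 4 + ε₃ π / 6` of the integrand, with `εᵢ` the signs of `-u`,
`-w` and `Q(u, w)`, is `± π / 3` when `u` and `w` have the same sign, as `Q` then shares it, and
`± π / 6` otherwise. -/
theorem re_angularDensity_mul_fresnel_pos {θ : ℝ}
    (hθ : cos θ * sin θ * sumCubic (cos θ) (sin θ) ≠ 0) :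
    0 < (angularDensity θ * fresnel 3 (sumCubic (cos θ) (sin θ))).re := by
  have hc : cos θ ≠ 0 := left_ne_zero_of_mul (left_ne_zero_of_mul hθ)
  have hs : sin θ ≠ 0 := right_ne_zero_of_mul (left_ne_zero_of_mul hθ)
  have hq : sumCubic (cos θ) (sin θ) ≠ 0 := right_ne_zero_of_mul hθ
  set q := sumCubic (cos θ) (sin θ) with hqdef
  set a := -(3 / 4) * cos θ with ha
  set b := -(3 / 4) * sin θ with hb
  have ha0 : a ≠ 0 := mul_ne_zero (by norm_num) hc
  have hb0 : b ≠ 0 := mul_ne_zero (by norm_num) hs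
  have hne : ∀ x : ℝ, x ≠ 0 → Complex.I / (x : ℂ) ≠ 0 := fun x hx =>
    div_ne_zero Complex.I_ne_zero (by exact_mod_cast hx)
  set L : ℝ → ℂ := fun x => Complex.log (Complex.I / x)
  set G₂ := Real.Gamma (1 / (2 : ℕ) + 1)
  set G₃ := Real.Gamma (1 / (3 : ℕ) + 1)
  have hG₂ : 0 < G₂ := Real.Gamma_pos_of_pos (by positivity)
  have hG₃ : 0 < G₃ := Real.Gamma_pos_of_pos (by positivity)
  have e : angularDensity θ * fresnel 3 q =
      ((G₂ * G₂ * G₃ : ℝ) : ℂ) * Complex.exp (L a / 2 + L b / 2 + L q / 3) := by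
    have f2 : ∀ x : ℝ, x ≠ 0 → fresnel 2 x = (G₂ : ℂ) * Complex.exp (L x / 2) := fun x hx => by
      rw [fresnel, Complex.cpow_def_of_ne_zero (hne x hx)]
      congr 2
      simp only [L]; push_cast; ring
    have f3 : ∀ x : ℝ, x ≠ 0 → fresnel 3 x = (G₃ : ℂ) * Complex.exp (L x / 3) := fun x hx => by
      rw [fresnel, Complex.cpow_def_of_ne_zero (hne x hx)]
      congr 2
      simp only [L]; push_cast; ring
    rw [angularDensity, f2 a ha0, f2 b hb0, f3 q hq, Complex.exp_add, Complex.exp_add,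
      Complex.ofReal_mul, Complex.ofReal_mul]
    ring
  rw [e, Complex.re_ofReal_mul, Complex.exp_re]
  refine mul_pos (by positivity) (mul_pos (exp_pos _) (cos_pos_of_mem_Ioo ?_))
  have him : (L a / 2 + L b / 2 + L q / 3).im =
      (SignType.sign a : ℝ) * (π / 4) + (SignType.sign b : ℝ) * (π / 4) +
        (SignType.sign q : ℝ) * (π / 6) := by
    have h2 : ∀ z : ℂ, (z / 2).im = z.im / 2 := fun z => by simp
    have h3 : ∀ z : ℂ, (z / 3).im = z.im / 3 := fun z => by simp
    rw [Complex.add_im, Complex.add_im, h2, h2, h3, log_I_div_im ha0, log_I_div_im hb0,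
      log_I_div_im hq]
    ring
  rw [him]
  have hpi := pi_pos
  rcases lt_or_gt_of_ne hc with h1 | h1 <;> rcases lt_or_gt_of_ne hs with h2 | h2
  · have h3 : q < 0 := by
      have : 0 < cos θ * sin θ := mul_pos_of_neg_of_neg h1 h2
      rw [hqdef, sumCubic]
      have h4 : 0 < cos θ ^ 2 + 3 * cos θ * sin θ + sin θ ^ 2 := by nlinarith
      have := mul_neg_of_neg_of_pos (add_neg h1 h2) h4
      linarith
    rw [sign_pos (show 0 < a by linarith), sign_pos (show 0 < b by linarith), sign_neg h3]
    constructor <;> simp <;> linarith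
  · rw [sign_pos (show 0 < a by linarith), sign_neg (show b < 0 by linarith)]
    rcases lt_or_gt_of_ne hq with h3 | h3
    · rw [sign_neg h3]; constructor <;> simp <;> linarith
    · rw [sign_pos h3]; constructor <;> simp <;> linarith
  · rw [sign_neg (show a < 0 by linarith), sign_pos (show 0 < b by linarith)]
    rcases lt_or_gt_of_ne hq with h3 | h3
    · rw [sign_neg h3]; constructor <;> simp <;> linarith
    · rw [sign_pos h3]; constructor <;> simp <;> linarith
  · have h3 : 0 < q := by
      have : 0 < cos θ * sin θ := mul_pos h1 h2
      rw [hqdef, sumCubic]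
      positivity
    rw [sign_neg (show a < 0 by linarith), sign_neg (show b < 0 by linarith), sign_pos h3]
    constructor <;> simp <;> linarith

open Real Set in
theorem leadingCoeff_ne_zero : leadingCoeff ≠ 0 := by
  have hint := integrableOn_angularDensity_mul_fresnel
  have hpos := ae_cos_mul_sin_mul_sumCubic_ne_zero.mono fun θ hθ =>
    re_angularDensity_mul_fresnel_pos hθ
  have h : 0 < leadingCoeff.re := by
    have e : leadingCoeff.re = ∫ θ in Ioo (-π) π,
        (angularDensity θ * fresnel 3 (sumCubic (cos θ) (sin θ))).re := (integral_re hint).symm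
    rw [e, integral_pos_iff_support_of_nonneg_ae (hpos.mono fun θ h => h.le) hint.re]
    have hsupp : Function.support (fun θ =>
        (angularDensity θ * fresnel 3 (sumCubic (cos θ) (sin θ))).re)
        =ᵐ[volume.restrict (Ioo (-π) π)] univ :=
      eventuallyEq_univ.2 (hpos.mono fun θ h => h.ne')
    rw [measure_congr hsupp]
    simp [pi_pos]
  intro h0
  rw [h0] at h
  simp at h

/-! ### The planar integral in polar coordinates -/

theorem IsCutoff.comp_sq {χ : ℝ → ℝ} (hχ : IsCutoff χ) : IsCutoff (fun r => χ (r ^ 2)) := by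
  refine ⟨hχ.contDiff.comp (by fun_prop), ?_, ?_⟩
  · obtain ⟨R, hR⟩ := hχ.hasCompactSupport.isCompact.isBounded.subset_closedBall 0
    refine HasCompactSupport.of_support_subset_isCompact (isCompact_closedBall (0 : ℝ) (R + 1)) ?_
    intro r hr
    have h1 : r ^ 2 ∈ Metric.closedBall (0 : ℝ) R := hR (subset_tsupport χ hr)
    rw [mem_closedBall_zero_iff, Real.norm_eq_abs] at h1 ⊢
    rw [abs_of_nonneg (sq_nonneg r)] at h1
    refine abs_le_of_sq_le_sq (by nlinarith [sq_nonneg r]) (by nlinarith [sq_nonneg r])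
  · have h : Tendsto (fun r : ℝ => r ^ 2) (𝓝 0) (𝓝 0) := by
      simpa using (continuous_pow 2).tendsto (0 : ℝ)
    exact h.eventually hχ.eventually_eq_one

theorem norm_cexp_I_mul_mul (t x : ℝ) : ‖Complex.exp (Complex.I * t * x)‖ = 1 := by
  have : Complex.I * t * (x : ℂ) = ((t * x : ℝ) : ℂ) * Complex.I := by push_cast; ring
  rw [this, Complex.norm_exp_ofReal_mul_I]

open Real Set in
/-- In polar coordinates the homogeneity of `sumCubic` and of `fresnel 2` makes the integrand a
product of an angular density and a Fresnel-type integrand of order `3` in the radius. -/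
theorem integral_sumCubic_eq_angular {χ : ℝ → ℝ} (hχ : IsCutoff χ) {t : ℝ} (ht : 0 < t) :
    IntegrableOn (fun θ => angularDensity θ *
        cutoffFresnel 3 (fun r => χ (r ^ 2)) (t * sumCubic (cos θ) (sin θ))) (Ioo (-π) π) ∧
    ∫ p : ℝ × ℝ, (χ (p.1 ^ 2 + p.2 ^ 2) : ℂ) * Complex.exp (Complex.I * t * sumCubic p.1 p.2) *
        (fresnel 2 (t * (-(3 / 4) * p.1)) * fresnel 2 (t * (-(3 / 4) * p.2))) =
      ((t⁻¹ : ℝ) : ℂ) * ∫ θ in Ioo (-π) π, angularDensity θ *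
        cutoffFresnel 3 (fun r => χ (r ^ 2)) (t * sumCubic (cos θ) (sin θ)) := by
  set f : ℝ × ℝ → ℂ := fun p =>
    (χ (p.1 ^ 2 + p.2 ^ 2) : ℂ) * Complex.exp (Complex.I * t * sumCubic p.1 p.2) *
        (fresnel 2 (t * (-(3 / 4) * p.1)) * fresnel 2 (t * (-(3 / 4) * p.2))) with hf
  set g : ℝ × ℝ → ℂ := fun p => (χ (p.1 ^ 2) : ℂ) * angularDensity p.2 *
    Complex.exp (Complex.I * (t * sumCubic (cos p.2) (sin p.2) : ℝ) * p.1 ^ 3) with hg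
  -- The Jacobian `r` cancels the two factors `(t r) ^ (-1/2)`, up to `t⁻¹`.
  have hpolar : ∀ p ∈ polarCoord.target, p.1 • f (polarCoord.symm p) = ((t⁻¹ : ℝ) : ℂ) * g p := by
    rintro ⟨r, θ⟩ hp
    have hr : 0 < r := hp.1
    have hhom : ∀ x : ℝ, fresnel 2 (t * (-(3 / 4) * (r * x))) =
        (((t * r) ^ (-(1 / 2) : ℝ) : ℝ) : ℂ) * fresnel 2 (-(3 / 4) * x) := fun x => by
      have := fresnel_mul (p := 2) (mul_pos ht hr) (-(3 / 4) * x)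
      rw [Nat.cast_ofNat] at this
      rw [← this]; ring_nf
    have hsq : (((t * r) ^ (-(1 / 2) : ℝ) : ℝ) : ℂ) * (((t * r) ^ (-(1 / 2) : ℝ) : ℝ) : ℂ) =
        (((t * r)⁻¹ : ℝ) : ℂ) := by
      rw [← Complex.ofReal_mul, ← rpow_add (mul_pos ht hr), ← rpow_neg_one]; norm_num
    have h1 : (r * cos θ) ^ 2 + (r * sin θ) ^ 2 = r ^ 2 := by
      linear_combination r ^ 2 * sin_sq_add_cos_sq θ
    have hr' : (r : ℂ) * (((t * r)⁻¹ : ℝ) : ℂ) = ((t⁻¹ : ℝ) : ℂ) := by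
      rw [← Complex.ofReal_mul]; congr 1; field_simp
    have hph : Complex.I * t * ((r ^ 3 * sumCubic (cos θ) (sin θ) : ℝ) : ℂ) =
        Complex.I * ((t * sumCubic (cos θ) (sin θ) : ℝ) : ℂ) * (r : ℂ) ^ 3 := by push_cast; ring
    simp only [hf, hg, polarCoord_symm_apply, hhom, h1, sumCubic_mul_mul, angularDensity,
      Complex.real_smul, hph]
    set X := (((t * r) ^ (-(1 / 2) : ℝ) : ℝ) : ℂ)
    linear_combination ((χ (r ^ 2) : ℂ) *
      Complex.exp (Complex.I * (t * sumCubic (cos θ) (sin θ) : ℝ) * r ^ 3) *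
      (fresnel 2 (-(3 / 4) * cos θ) * fresnel 2 (-(3 / 4) * sin θ))) * (r * hsq + hr')
  have hm : (volume : Measure (ℝ × ℝ)).restrict (Ioi 0 ×ˢ Ioo (-π) π) =
      ((volume : Measure ℝ).restrict (Ioi 0)).prod ((volume : Measure ℝ).restrict (Ioo (-π) π)) :=
    (Measure.prod_restrict _ _).symm
  have hα := hχ.comp_sq
  have hgint : Integrable g (((volume : Measure ℝ).restrict (Ioi 0)).prod
      ((volume : Measure ℝ).restrict (Ioo (-π) π))) := by
    have h1 : Integrable (fun r : ℝ => ((χ (r ^ 2) : ℝ) : ℂ)) (volume.restrict (Ioi 0)) :=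
      (hα.contDiff.continuous.integrable_of_hasCompactSupport
        hα.hasCompactSupport).ofReal.integrableOn
    refine (h1.mul_prod integrableOn_angularDensity).mul_bdd (c := 1) ?_
      (Eventually.of_forall fun p => ?_)
    · exact Continuous.aestronglyMeasurable (by unfold sumCubic; fun_prop)
    · have := norm_cexp_I_mul_mul (t * sumCubic (cos p.2) (sin p.2)) (p.1 ^ 3)
      push_cast at this ⊢
      exact this.le
  have hinner : ∀ θ, ∫ r in Ioi (0 : ℝ), g (r, θ) = angularDensity θ *
      cutoffFresnel 3 (fun r => χ (r ^ 2)) (t * sumCubic (cos θ) (sin θ)) := fun θ => by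
    rw [cutoffFresnel, ← integral_const_mul]
    congr 1
    funext r
    simp only [hg]; ring
  refine ⟨?_, ?_⟩
  · have := hgint.integral_prod_right
    simp only [hinner] at this
    exact this
  · rw [← integral_comp_polarCoord_symm, setIntegral_congr_fun
      polarCoord.open_target.measurableSet hpolar, integral_const_mul, polarCoord_target, hm,
      integral_prod_symm _ hgint]
    simp only [hinner]

open Real Set in
/-- Leading term of the planar integral. The remainder bound for Fresnel integrals of order `3` is
used with exponent `1 / 2`, which keeps the angular integral convergent. -/
theorem exists_norm_integral_sumCubic_sub_le {χ : ℝ → ℝ} (hχ : IsCutoff χ) :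
    ∃ C, 0 ≤ C ∧ ∀ t : ℝ, 0 < t →
      ‖(∫ p : ℝ × ℝ, (χ (p.1 ^ 2 + p.2 ^ 2) : ℂ) * Complex.exp (Complex.I * t * sumCubic p.1 p.2) *
        (fresnel 2 (t * (-(3 / 4) * p.1)) * fresnel 2 (t * (-(3 / 4) * p.2)))) -
        leadingCoeff * ((t ^ (-(4 / 3) : ℝ) : ℝ) : ℂ)‖ ≤ C * t ^ (-(3 / 2) : ℝ) := by
  obtain ⟨C, hC, h⟩ := hχ.comp_sq.exists_norm_sub_fresnel_le_rpow (p := 3) (by norm_num)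
  set I := ∫ θ in Ioo (-π) π, ‖angularDensity θ‖ * |sumCubic (cos θ) (sin θ)| ^ (-(1 / 2) : ℝ)
  have hI : 0 ≤ I := integral_nonneg fun θ => by positivity
  refine ⟨C * I, by positivity, fun t ht => ?_⟩
  obtain ⟨hint, heq⟩ := integral_sumCubic_eq_angular hχ ht
  have hlead : leadingCoeff * ((t ^ (-(4 / 3) : ℝ) : ℝ) : ℂ) = ((t⁻¹ : ℝ) : ℂ) *
      ∫ θ in Ioo (-π) π, ((t ^ (-(1 / 3) : ℝ) : ℝ) : ℂ) *
        (angularDensity θ * fresnel 3 (sumCubic (cos θ) (sin θ))) := by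
    rw [integral_const_mul, ← leadingCoeff, ← mul_assoc, ← Complex.ofReal_mul, ← rpow_neg_one,
      ← rpow_add ht, mul_comm]
    norm_num
  rw [heq, hlead, ← mul_sub, ← integral_sub hint
    (integrableOn_angularDensity_mul_fresnel.const_mul _), norm_mul, Complex.norm_real,
    norm_of_nonneg (inv_pos.2 ht).le]
  have hle : ‖∫ θ in Ioo (-π) π, (angularDensity θ *
        cutoffFresnel 3 (fun r => χ (r ^ 2)) (t * sumCubic (cos θ) (sin θ)) -
      ((t ^ (-(1 / 3) : ℝ) : ℝ) : ℂ) *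
        (angularDensity θ * fresnel 3 (sumCubic (cos θ) (sin θ))))‖ ≤
      ∫ θ in Ioo (-π) π, C * t ^ (-(1 / 2) : ℝ) *
        (‖angularDensity θ‖ * |sumCubic (cos θ) (sin θ)| ^ (-(1 / 2) : ℝ)) := by
    refine norm_integral_le_of_norm_le (integrableOn_norm_angularDensity_mul_rpow.const_mul _) ?_
    filter_upwards [ae_cos_mul_sin_mul_sumCubic_ne_zero] with θ hθ
    have hq : sumCubic (cos θ) (sin θ) ≠ 0 := right_ne_zero_of_mul hθ
    have h1 := h (t * sumCubic (cos θ) (sin θ)) (mul_ne_zero ht.ne' hq) (1 / 2) (by norm_num)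
      (by norm_num)
    rw [fresnel_mul ht, abs_mul, abs_of_pos ht, mul_rpow ht.le (abs_nonneg _)] at h1
    rw [mul_left_comm, ← mul_sub, norm_mul]
    calc _ ≤ ‖angularDensity θ‖ * (C * (t ^ (-(1 / 2) : ℝ) *
          |sumCubic (cos θ) (sin θ)| ^ (-(1 / 2) : ℝ))) := by
          gcongr
          simpa using h1
      _ = _ := by ring
  rw [integral_const_mul] at hle
  calc _ ≤ t⁻¹ * (C * t ^ (-(1 / 2) : ℝ) * I) := by gcongr
    _ = C * I * t ^ (-(3 / 2) : ℝ) := by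
      have : t ^ (-(3 / 2) : ℝ) = t⁻¹ * t ^ (-(1 / 2) : ℝ) := by
        rw [← rpow_neg_one, ← rpow_add ht]; norm_num
      rw [this]; ring

/-! ### The error in the inner integrals -/

open Set in
/-- The power `|u| ^ (-s)` truncated to `[-B, B]`. -/
noncomputable def truncPow (B s : ℝ) : ℝ → ℝ :=
  indicator (Icc (-B) B) fun u => |u| ^ (-s)

theorem truncPow_nonneg (B s u : ℝ) : 0 ≤ truncPow B s u :=
  Set.indicator_nonneg (fun _ _ => by positivity) u

theorem truncPow_of_mem {B u : ℝ} (s : ℝ) (h : u ∈ Set.Icc (-B) B) :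
    truncPow B s u = |u| ^ (-s) := Set.indicator_of_mem h _

open Set in
theorem integrable_truncPow {B s : ℝ} (hB : 1 ≤ B) (hs0 : 0 ≤ s) (hs : s < 1) :
    Integrable (truncPow B s) ∧ ∫ u, truncPow B s u ≤ 2 * B / (1 - s) := by
  have hB0 : 0 ≤ B := by linarith
  have hcongr : ∀ u ∈ uIoc 0 B, u ^ (-s) = |u| ^ (-s) := fun u hu => by
    rw [uIoc_of_le hB0] at hu
    rw [abs_of_pos hu.1]
  have h1 : IntervalIntegrable (fun u : ℝ => |u| ^ (-s)) volume 0 B :=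
    (intervalIntegral.intervalIntegrable_rpow' (r := -s) (by linarith)).congr hcongr
  have h2 : IntervalIntegrable (fun u : ℝ => |u| ^ (-s)) volume (-B) 0 := by
    have := (h1.comp_sub_left 0).symm
    simpa using this
  have e1 : ∫ u in (0 : ℝ)..B, |u| ^ (-s) = B ^ (1 - s) / (1 - s) := by
    rw [← intervalIntegral.integral_congr_ae (Eventually.of_forall hcongr),
      integral_rpow (Or.inl (by linarith)), Real.zero_rpow (by linarith)]
    ring_nf
  have e2 : ∫ u in (-B)..(0 : ℝ), |u| ^ (-s) = B ^ (1 - s) / (1 - s) := by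
    rw [← e1]
    have := intervalIntegral.integral_comp_neg (a := 0) (b := B) (fun u : ℝ => |u| ^ (-s))
    simpa using this.symm
  constructor
  · rw [truncPow, integrable_indicator_iff measurableSet_Icc, integrableOn_Icc_iff_integrableOn_Ioc]
    exact (intervalIntegrable_iff_integrableOn_Ioc_of_le (by linarith)).1 (h2.trans h1)
  · rw [truncPow, integral_indicator measurableSet_Icc, integral_Icc_eq_integral_Ioc,
      ← intervalIntegral.integral_of_le (by linarith),
      ← intervalIntegral.integral_add_adjacent_intervals h2 h1, e1, e2, ← add_div]
    have : B ^ (1 - s) ≤ B := by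
      simpa using Real.rpow_le_rpow_of_exponent_le hB (show 1 - s ≤ 1 by linarith)
    gcongr
    linarith

/-- Points at which a radial cutoff does not vanish lie in a fixed square. -/
theorem IsCutoff.exists_mem_Icc {χ : ℝ → ℝ} (hχ : IsCutoff χ) :
    ∃ B, 1 ≤ B ∧ ∀ u w : ℝ, χ (u ^ 2 + w ^ 2) ≠ 0 →
      u ∈ Set.Icc (-B) B ∧ w ∈ Set.Icc (-B) B := by
  obtain ⟨R, hR⟩ := hχ.hasCompactSupport.isCompact.isBounded.subset_closedBall 0
  have hR0 : 0 ≤ R := by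
    have h0 : χ 0 ≠ 0 := by rw [hχ.eventually_eq_one.self_of_nhds]; exact one_ne_zero
    simpa using hR (subset_tsupport χ h0)
  refine ⟨R + 1, by linarith, fun u w h => ?_⟩
  have h1 : u ^ 2 + w ^ 2 ∈ Metric.closedBall (0 : ℝ) R := hR (subset_tsupport χ h)
  rw [mem_closedBall_zero_iff, Real.norm_eq_abs, abs_of_nonneg (by positivity)] at h1
  constructor
  · exact abs_le.1 (abs_le_of_sq_le_sq (by nlinarith [sq_nonneg w]) (by linarith))
  · exact abs_le.1 (abs_le_of_sq_le_sq (by nlinarith [sq_nonneg u]) (by linarith))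

theorem IsCutoff.integrable_comp_sq_add_sq {χ : ℝ → ℝ} (hχ : IsCutoff χ) :
    Integrable (fun p : ℝ × ℝ => (χ (p.1 ^ 2 + p.2 ^ 2) : ℂ)) := by
  obtain ⟨B, hB, hsupp⟩ := hχ.exists_mem_Icc
  refine Continuous.integrable_of_hasCompactSupport
    (by have := hχ.contDiff.continuous; fun_prop) ?_
  refine HasCompactSupport.of_support_subset_isCompact
    ((isCompact_Icc (a := -B) (b := B)).prod (isCompact_Icc (a := -B) (b := B))) fun p hp => ?_
  exact hsupp p.1 p.2 (by simpa using hp)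

open Set in
theorem IsCutoff.integral_comp_sq_mul_cexp {χ : ℝ → ℝ} (hχ : IsCutoff χ) (μ : ℝ) :
    ∫ v : ℝ, (χ (v ^ 2) : ℂ) * Complex.exp (Complex.I * μ * v ^ 2) =
      2 * cutoffFresnel 2 (fun r => χ (r ^ 2)) μ := by
  set f : ℝ → ℂ := fun v => (χ (v ^ 2) : ℂ) * Complex.exp (Complex.I * μ * v ^ 2)
  have hα := hχ.comp_sq
  have hint : Integrable f := by
    refine (hα.contDiff.continuous.integrable_of_hasCompactSupport
      hα.hasCompactSupport).ofReal.mul_bdd (c := 1)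
      (Continuous.aestronglyMeasurable (by fun_prop)) (Eventually.of_forall fun v => ?_)
    have := norm_cexp_I_mul_mul μ (v ^ 2)
    push_cast at this
    exact this.le
  have hneg : ∫ v in Iic (0 : ℝ), f v = ∫ v in Ioi (0 : ℝ), f v := by
    -- The integrand is even.
    have := integral_comp_neg_Ioi 0 f
    rw [neg_zero] at this
    rw [← this]
    simp [f]
  rw [← intervalIntegral.integral_Iic_add_Ioi hint.integrableOn hint.integrableOn (b := 0), hneg,
    cutoffFresnel]
  ring

/-- Replacing both inner Fresnel integrals by their leading terms costs `O(t ^ (-3/2) log t)`. The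
exponent `s = 1 - 1 / log t` of the remainder bound is what produces the logarithm. -/
theorem IsCutoff.exists_norm_integral_sub_integral_fresnel_le {χ : ℝ → ℝ} (hχ : IsCutoff χ) :
    ∃ C, 0 ≤ C ∧ ∀ t : ℝ, Real.exp 2 ≤ t →
      Integrable (fun p : ℝ × ℝ => (χ (p.1 ^ 2 + p.2 ^ 2) : ℂ) *
        Complex.exp (Complex.I * t * sumCubic p.1 p.2) *
          (cutoffFresnel 2 (fun r => χ (r ^ 2)) (t * (-(3 / 4) * p.1)) *
            cutoffFresnel 2 (fun r => χ (r ^ 2)) (t * (-(3 / 4) * p.2)))) →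
      ‖(∫ p : ℝ × ℝ, (χ (p.1 ^ 2 + p.2 ^ 2) : ℂ) *
        Complex.exp (Complex.I * t * sumCubic p.1 p.2) *
          (cutoffFresnel 2 (fun r => χ (r ^ 2)) (t * (-(3 / 4) * p.1)) *
            cutoffFresnel 2 (fun r => χ (r ^ 2)) (t * (-(3 / 4) * p.2)))) -
        ∫ p : ℝ × ℝ, (χ (p.1 ^ 2 + p.2 ^ 2) : ℂ) * Complex.exp (Complex.I * t * sumCubic p.1 p.2) *
        (fresnel 2 (t * (-(3 / 4) * p.1)) * fresnel 2 (t * (-(3 / 4) * p.2)))‖ ≤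
        C * (t ^ (-(3 / 2) : ℝ) * Real.log t) := by
  obtain ⟨C, hC, hrem⟩ := hχ.comp_sq.exists_norm_sub_fresnel_le_rpow (p := 2) le_rfl
  obtain ⟨D, hD, hDle⟩ := hχ.exists_abs_le
  obtain ⟨B, hB, hsupp⟩ := hχ.exists_mem_Icc
  set K := cutoffFresnel 2 (fun r => χ (r ^ 2))
  set G := Real.Gamma (1 / (2 : ℕ) + 1)
  have hG : 0 < G := Real.Gamma_pos_of_pos (by positivity)
  have hf : ∀ μ, ‖fresnel 2 μ‖ = G * |μ| ^ (-(1 / 2) : ℝ) := fun μ => by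
    rw [norm_fresnel]
    congr 2
  set M := D * (C * (G + C)) * (4 / 3) ^ 2
  refine ⟨M * (2 * (2 * B * (2 * B / (1 / 2)) * Real.exp 1)), by positivity, fun t ht hint => ?_⟩
  have ht0 : 0 < t := (Real.exp_pos 2).trans_le ht
  have hlog : 2 ≤ Real.log t := (Real.le_log_iff_exp_le ht0).2 ht
  set s := 1 - 1 / Real.log t
  have hs1 : s < 1 := by have : 0 < 1 / Real.log t := by positivity
                         simp only [s]; linarith
  have hs2 : 1 / 2 ≤ s := by
    have : 1 / Real.log t ≤ 1 / 2 := one_div_le_one_div_of_le (by norm_num) hlog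
    simp only [s]; linarith
  obtain ⟨hi1, hi2⟩ := integrable_truncPow hB (show 0 ≤ s by linarith) hs1
  obtain ⟨hj1, hj2⟩ := integrable_truncPow hB (show (0 : ℝ) ≤ 1 / 2 by norm_num) (by norm_num)
  have hfint : Integrable (fun p : ℝ × ℝ => (χ (p.1 ^ 2 + p.2 ^ 2) : ℂ) *
      Complex.exp (Complex.I * t * sumCubic p.1 p.2) *
        (fresnel 2 (t * (-(3 / 4) * p.1)) * fresnel 2 (t * (-(3 / 4) * p.2)))) := by
    refine Integrable.mono' ((hj1.mul_prod hj1).const_mul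
      (D * (G * (t * (3 / 4)) ^ (-(1 / 2) : ℝ)) ^ 2)) (Measurable.aestronglyMeasurable ?_)
      (Eventually.of_forall fun p => ?_)
    · have := measurable_fresnel 2
      have := hχ.contDiff.continuous.measurable
      unfold sumCubic
      fun_prop
    · rcases eq_or_ne (χ (p.1 ^ 2 + p.2 ^ 2)) 0 with h0 | h0
      · simp only [h0, Complex.ofReal_zero, zero_mul, norm_zero]
        have := truncPow_nonneg B (1 / 2) p.1
        have := truncPow_nonneg B (1 / 2) p.2
        positivity
      · obtain ⟨hu, hw⟩ := hsupp _ _ h0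
        rw [truncPow_of_mem _ hu, truncPow_of_mem _ hw, norm_mul, norm_mul, norm_mul,
          norm_cexp_I_mul_mul, hf, hf, Complex.norm_real, Real.norm_eq_abs, mul_one]
        have e : ∀ x : ℝ, |t * (-(3 / 4) * x)| ^ (-(1 / 2) : ℝ) =
            (t * (3 / 4)) ^ (-(1 / 2) : ℝ) * |x| ^ (-(1 / 2) : ℝ) := fun x => by
          rw [← Real.mul_rpow (by positivity) (abs_nonneg _)]
          congr 1
          rw [abs_mul, abs_mul, abs_neg, abs_of_pos ht0,
            abs_of_pos (show (0 : ℝ) < 3 / 4 by norm_num)]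
          ring
        rw [e, e]
        calc _ ≤ D * _ := mul_le_mul_of_nonneg_right (hDle _) (by positivity)
          _ = _ := by ring
  have habs : ∀ x r : ℝ, 0 ≤ r → r ≤ 1 →
      |t * (-(3 / 4) * x)| ^ (-r) ≤ 4 / 3 * (t ^ (-r) * |x| ^ (-r)) := fun x r h0 h1 => by
    rw [abs_mul, abs_mul, abs_neg, abs_of_pos ht0,
      abs_of_pos (show (0 : ℝ) < 3 / 4 by norm_num), Real.mul_rpow ht0.le (by positivity),
      Real.mul_rpow (by norm_num) (abs_nonneg _)]
    have : (3 / 4 : ℝ) ^ (-r) ≤ 4 / 3 := by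
      calc (3 / 4 : ℝ) ^ (-r) ≤ (3 / 4 : ℝ) ^ (-1 : ℝ) :=
            Real.rpow_le_rpow_of_exponent_ge (by norm_num) (by norm_num) (by linarith)
        _ = 4 / 3 := by rw [Real.rpow_neg_one]; norm_num
    calc t ^ (-r) * ((3 / 4 : ℝ) ^ (-r) * |x| ^ (-r))
        ≤ t ^ (-r) * (4 / 3 * |x| ^ (-r)) := by gcongr
      _ = _ := by ring
  have hpt : ∀ᵐ p : ℝ × ℝ, ‖(χ (p.1 ^ 2 + p.2 ^ 2) : ℂ) *
      Complex.exp (Complex.I * t * sumCubic p.1 p.2) *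
        (K (t * (-(3 / 4) * p.1)) * K (t * (-(3 / 4) * p.2))) -
      (χ (p.1 ^ 2 + p.2 ^ 2) : ℂ) * Complex.exp (Complex.I * t * sumCubic p.1 p.2) *
        (fresnel 2 (t * (-(3 / 4) * p.1)) * fresnel 2 (t * (-(3 / 4) * p.2)))‖ ≤
      M * (t ^ (-s) * t ^ (-(1 / 2) : ℝ)) * (truncPow B s p.1 * truncPow B (1 / 2) p.2 +
        truncPow B (1 / 2) p.1 * truncPow B s p.2) := by
    -- The remainder bound has no content at parameter `0`, so the two axes are discarded.
    have hne : ∀ᵐ x : ℝ, x ≠ 0 := by simp [ae_iff]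
    filter_upwards [Measure.quasiMeasurePreserving_fst.ae hne,
      Measure.quasiMeasurePreserving_snd.ae hne] with p hp1 hp2
    rcases eq_or_ne (χ (p.1 ^ 2 + p.2 ^ 2)) 0 with h0 | h0
    · simp only [h0, Complex.ofReal_zero, zero_mul, sub_self, norm_zero]
      have := truncPow_nonneg B (1 / 2) p.1
      have := truncPow_nonneg B (1 / 2) p.2
      have := truncPow_nonneg B s p.1
      have := truncPow_nonneg B s p.2
      positivity
    · obtain ⟨hu, hw⟩ := hsupp _ _ h0
      rw [truncPow_of_mem _ hu, truncPow_of_mem _ hw, truncPow_of_mem _ hu, truncPow_of_mem _ hw,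
        ← mul_sub, norm_mul, norm_mul, norm_cexp_I_mul_mul, Complex.norm_real, Real.norm_eq_abs,
        mul_one]
      have ha : t * (-(3 / 4) * p.1) ≠ 0 := mul_ne_zero ht0.ne' (mul_ne_zero (by norm_num) hp1)
      have hb : t * (-(3 / 4) * p.2) ≠ 0 := mul_ne_zero ht0.ne' (mul_ne_zero (by norm_num) hp2)
      set a := t * (-(3 / 4) * p.1) with hadef
      set b := t * (-(3 / 4) * p.2) with hbdef
      have hKa : ‖K a‖ ≤ (G + C) * |a| ^ (-(1 / 2) : ℝ) := by
        have h1 := hrem a ha (1 / 2) (by norm_num) (by norm_num)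
        have h2 := norm_add_le (K a - fresnel 2 a) (fresnel 2 a)
        rw [sub_add_cancel, hf] at h2
        linarith
      have hRa := hrem a ha s (by exact_mod_cast hs2) hs1.le
      have hRb := hrem b hb s (by exact_mod_cast hs2) hs1.le
      have hprod : ‖K a * K b - fresnel 2 a * fresnel 2 b‖ ≤
          C * (G + C) * (|a| ^ (-s) * |b| ^ (-(1 / 2) : ℝ) +
            |a| ^ (-(1 / 2) : ℝ) * |b| ^ (-s)) := by
        have e : K a * K b - fresnel 2 a * fresnel 2 b =
          (K a - fresnel 2 a) * fresnel 2 b + K a * (K b - fresnel 2 b) := by ring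
        calc _ ≤ ‖K a - fresnel 2 a‖ * ‖fresnel 2 b‖ + ‖K a‖ * ‖K b - fresnel 2 b‖ := by
              rw [e, ← norm_mul, ← norm_mul]; exact norm_add_le _ _
          _ ≤ (C * |a| ^ (-s)) * ((G + C) * |b| ^ (-(1 / 2) : ℝ)) +
              ((G + C) * |a| ^ (-(1 / 2) : ℝ)) * (C * |b| ^ (-s)) := by
            have : ‖fresnel 2 b‖ ≤ (G + C) * |b| ^ (-(1 / 2) : ℝ) := by
              rw [hf]; gcongr; linarith
            gcongr
          _ = _ := by ring
      have a1 := habs p.1 s (by linarith) hs1.le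
      have a2 := habs p.2 s (by linarith) hs1.le
      have a3 := habs p.1 (1 / 2) (by norm_num) (by norm_num)
      have a4 := habs p.2 (1 / 2) (by norm_num) (by norm_num)
      rw [← hadef] at a1 a3
      rw [← hbdef] at a2 a4
      calc _ ≤ D * (C * (G + C) * (|a| ^ (-s) * |b| ^ (-(1 / 2) : ℝ) +
            |a| ^ (-(1 / 2) : ℝ) * |b| ^ (-s))) := by gcongr; exact hDle _
        _ ≤ D * (C * (G + C) * ((4 / 3 * (t ^ (-s) * |p.1| ^ (-s))) *
              (4 / 3 * (t ^ (-(1 / 2) : ℝ) * |p.2| ^ (-(1 / 2) : ℝ))) +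
            (4 / 3 * (t ^ (-(1 / 2) : ℝ) * |p.1| ^ (-(1 / 2) : ℝ))) *
              (4 / 3 * (t ^ (-s) * |p.2| ^ (-s))))) := by gcongr
        _ = _ := by simp only [M]; ring
  rw [← integral_sub hint hfint]
  have hdom1 : Integrable (fun p : ℝ × ℝ => truncPow B s p.1 * truncPow B (1 / 2) p.2) :=
    hi1.mul_prod hj1
  have hdom2 : Integrable (fun p : ℝ × ℝ => truncPow B (1 / 2) p.1 * truncPow B s p.2) :=
    hj1.mul_prod hi1
  refine (norm_integral_le_of_norm_le ((hdom1.add hdom2).const_mul _) hpt).trans ?_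
  rw [integral_const_mul]
  have esum : ∫ p : ℝ × ℝ, ((fun p : ℝ × ℝ => truncPow B s p.1 * truncPow B (1 / 2) p.2) +
      fun p : ℝ × ℝ => truncPow B (1 / 2) p.1 * truncPow B s p.2) p =
      2 * ((∫ u, truncPow B s u) * ∫ u, truncPow B (1 / 2) u) := by
    rw [integral_add' hdom1 hdom2]
    have e1 := integral_prod_mul (μ := (volume : Measure ℝ)) (ν := (volume : Measure ℝ))
      (truncPow B s) (truncPow B (1 / 2))
    have e2 := integral_prod_mul (μ := (volume : Measure ℝ)) (ν := (volume : Measure ℝ))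
      (truncPow B (1 / 2)) (truncPow B s)
    rw [← Measure.volume_eq_prod] at e1 e2
    rw [e1, e2]; ring
  rw [esum]
  have hn1 : 0 ≤ ∫ u, truncPow B s u := integral_nonneg (truncPow_nonneg B s)
  have hn2 : 0 ≤ ∫ u, truncPow B (1 / 2) u := integral_nonneg (truncPow_nonneg B _)
  have hM : 0 ≤ M := by positivity
  -- The loss `t ^ (1 / log t)` in the power of `t` is the constant `e`.
  have ets : t ^ (-s) * t ^ (-(1 / 2) : ℝ) = Real.exp 1 * t ^ (-(3 / 2) : ℝ) := by
    have e1 : Real.exp 1 = t ^ (1 / Real.log t) := by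
      rw [Real.rpow_def_of_pos ht0, mul_one_div_cancel (by linarith)]
    rw [e1, ← Real.rpow_add ht0, ← Real.rpow_add ht0]
    congr 1
    simp only [s]; ring
  -- The integral of `|u| ^ (-s)` has size `1 / (1 - s) = log t`.
  have ediv : 2 * B / (1 - s) = 2 * B * Real.log t := by
    simp only [s, sub_sub_cancel]
    rw [div_div_eq_mul_div, div_one]
  rw [ediv] at hi2
  rw [ets]
  have hj3 : ∫ u, truncPow B (1 / 2) u ≤ 2 * B / (1 / 2) := by
    refine hj2.trans_eq ?_
    norm_num
  calc M * (Real.exp 1 * t ^ (-(3 / 2) : ℝ)) *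
        (2 * ((∫ u, truncPow B s u) * ∫ u, truncPow B (1 / 2) u))
      ≤ M * (Real.exp 1 * t ^ (-(3 / 2) : ℝ)) *
        (2 * ((2 * B * Real.log t) * (2 * B / (1 / 2)))) := by gcongr
    _ = _ := by ring

/-! ### Asymptotics on `ℝ⁴` -/

/-- A linear change of variables multiplies integrals by a nonzero constant. -/
theorem exists_integral_comp_continuousLinearEquiv {E F : Type*}
    [NormedAddCommGroup E] [NormedSpace ℝ E] [FiniteDimensional ℝ E] [MeasurableSpace E]
    [BorelSpace E] [NormedAddCommGroup F] [NormedSpace ℝ F] [MeasurableSpace F]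
    [BorelSpace F] (e : E ≃L[ℝ] F) (μ : Measure E) [μ.IsAddHaarMeasure] (ν : Measure F)
    [ν.IsAddHaarMeasure] :
    ∃ k : ℝ, k ≠ 0 ∧ ∀ f : F → ℂ, ∫ x, f (e x) ∂μ = k * ∫ y, f y ∂ν := by
  have : FiniteDimensional ℝ F := e.toLinearEquiv.finiteDimensional
  have : ProperSpace F := FiniteDimensional.proper ℝ F
  have : (μ.map e).IsAddHaarMeasure := e.isAddHaarMeasure_map μ
  obtain ⟨c, hc0, hc⟩ : ∃ c : NNReal, 0 < c ∧ μ.map e = c • ν :=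
    ⟨_, Measure.addHaarScalarFactor_pos_of_isAddHaarMeasure (μ.map e) ν,
      Measure.isAddLeftInvariant_eq_smul (μ.map e) ν⟩
  refine ⟨c, by exact_mod_cast hc0.ne', fun f => ?_⟩
  have h := e.toHomeomorph.measurableEmbedding.integral_map (μ := μ) f
  have h' : ∫ y, f y ∂(μ.map e) = ∫ x, f (e x) ∂μ := h
  rw [← h', hc, integral_smul_nnreal_measure]
  rfl

/-- The linear coordinates `((ξ₁ + ξ₂, ξ₃ + ξ₄), (ξ₁ - ξ₂, ξ₃ - ξ₄))` on `ℝ⁴`. -/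
noncomputable def sumDiffEquiv : (Fin 4 → ℝ) ≃L[ℝ] (ℝ × ℝ) × (ℝ × ℝ) :=
  LinearEquiv.toContinuousLinearEquiv
    { toFun := fun ξ => ((ξ 0 + ξ 1, ξ 2 + ξ 3), (ξ 0 - ξ 1, ξ 2 - ξ 3))
      map_add' := fun x y => by
        simp only [Pi.add_apply, Prod.mk_add_mk]
        ring_nf
      map_smul' := fun c x => by
        simp only [Pi.smul_apply, smul_eq_mul, RingHom.id_apply, Prod.smul_mk]
        ring_nf
      invFun := fun p => ![(p.1.1 + p.2.1) / 2, (p.1.1 - p.2.1) / 2,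
        (p.1.2 + p.2.2) / 2, (p.1.2 - p.2.2) / 2]
      left_inv := fun x => by
        funext i
        fin_cases i <;> simp
      right_inv := fun p => by
        obtain ⟨⟨a, b⟩, ⟨c, d⟩⟩ := p
        simp only [Matrix.cons_val]
        ring_nf }

theorem sumDiffEquiv_apply (ξ : Fin 4 → ℝ) :
    sumDiffEquiv ξ = ((ξ 0 + ξ 1, ξ 2 + ξ 3), (ξ 0 - ξ 1, ξ 2 - ξ 3)) := rfl

theorem cubicP4_eq (ξ : Fin 4 → ℝ) :
    cubicP4 ξ = sumCubic (ξ 0 + ξ 1) (ξ 2 + ξ 3) +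
      (-(3 / 4) * (ξ 0 + ξ 1) * (ξ 0 - ξ 1) ^ 2 + -(3 / 4) * (ξ 2 + ξ 3) * (ξ 2 - ξ 3) ^ 2) := by
  simp only [cubicP4, sumCubic, Fin.sum_univ_four]
  ring

/-- The amplitude on `ℝ⁴` adapted to the coordinates `sumDiffEquiv`: a radial cutoff in the two
sums times a cutoff in each difference. -/
noncomputable def amplitude (χ : ℝ → ℝ) (ξ : Fin 4 → ℝ) : ℝ :=
  χ ((ξ 0 + ξ 1) ^ 2 + (ξ 2 + ξ 3) ^ 2) * (χ ((ξ 0 - ξ 1) ^ 2) * χ ((ξ 2 - ξ 3) ^ 2))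

/-- Fubini: the integrals in the two differences are Fresnel integrals with parameters proportional
to the two sums. -/
theorem IsCutoff.exists_oscillatoryIntegral_cubicP4_eq {χ : ℝ → ℝ} (hχ : IsCutoff χ) :
    ∃ k : ℝ, k ≠ 0 ∧ ∀ t : ℝ,
      Integrable (fun p : ℝ × ℝ => (χ (p.1 ^ 2 + p.2 ^ 2) : ℂ) *
        Complex.exp (Complex.I * t * sumCubic p.1 p.2) *
          (cutoffFresnel 2 (fun r => χ (r ^ 2)) (t * (-(3 / 4) * p.1)) *
            cutoffFresnel 2 (fun r => χ (r ^ 2)) (t * (-(3 / 4) * p.2)))) ∧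
      oscillatoryIntegral cubicP4 (amplitude χ) t = k *
        ∫ p : ℝ × ℝ, (χ (p.1 ^ 2 + p.2 ^ 2) : ℂ) *
        Complex.exp (Complex.I * t * sumCubic p.1 p.2) *
          (cutoffFresnel 2 (fun r => χ (r ^ 2)) (t * (-(3 / 4) * p.1)) *
            cutoffFresnel 2 (fun r => χ (r ^ 2)) (t * (-(3 / 4) * p.2))) := by
  obtain ⟨k, hk, hchange⟩ := exists_integral_comp_continuousLinearEquiv sumDiffEquiv
    (volume : Measure (Fin 4 → ℝ)) ((volume : Measure (ℝ × ℝ)).prod (volume : Measure (ℝ × ℝ)))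
  have hα := hχ.comp_sq
  refine ⟨k * 4, mul_ne_zero hk (by norm_num), fun t => ?_⟩
  set phase : (ℝ × ℝ) × (ℝ × ℝ) → ℝ := fun x => sumCubic x.1.1 x.1.2 +
    (-(3 / 4) * x.1.1 * x.2.1 ^ 2 + -(3 / 4) * x.1.2 * x.2.2 ^ 2)
  set F : (ℝ × ℝ) × (ℝ × ℝ) → ℂ := fun x => (χ (x.1.1 ^ 2 + x.1.2 ^ 2) : ℂ) *
    ((χ (x.2.1 ^ 2) : ℂ) * (χ (x.2.2 ^ 2) : ℂ)) * Complex.exp (Complex.I * t * phase x) with hF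
  have hosc : oscillatoryIntegral cubicP4 (amplitude χ) t = k * ∫ x, F x
      ∂((volume : Measure (ℝ × ℝ)).prod (volume : Measure (ℝ × ℝ))) := by
    rw [← hchange, oscillatoryIntegral]
    congr 1
    funext ξ
    simp only [hF, phase, sumDiffEquiv_apply, cubicP4_eq, amplitude]
    rw [mul_comm]
    push_cast
    rfl
  have hone : Integrable (fun r : ℝ => ((χ (r ^ 2) : ℝ) : ℂ)) :=
    (hα.contDiff.continuous.integrable_of_hasCompactSupport hα.hasCompactSupport).ofReal
  have hFint : Integrable F ((volume : Measure (ℝ × ℝ)).prod (volume : Measure (ℝ × ℝ))) := by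
    refine (hχ.integrable_comp_sq_add_sq.mul_prod (hone.mul_prod hone)).mul_bdd (c := 1)
      (Continuous.aestronglyMeasurable (by simp only [phase, sumCubic]; fun_prop))
      (Eventually.of_forall fun x => (norm_cexp_I_mul_mul _ _).le)
  have hinner : ∀ p : ℝ × ℝ, ∫ q : ℝ × ℝ, F (p, q) = 4 * ((χ (p.1 ^ 2 + p.2 ^ 2) : ℂ) *
      Complex.exp (Complex.I * t * sumCubic p.1 p.2) *
        (cutoffFresnel 2 (fun r => χ (r ^ 2)) (t * (-(3 / 4) * p.1)) *
          cutoffFresnel 2 (fun r => χ (r ^ 2)) (t * (-(3 / 4) * p.2)))) := by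
    intro p
    set J : ℝ → ℝ → ℂ := fun μ v => (χ (v ^ 2) : ℂ) * Complex.exp (Complex.I * μ * v ^ 2)
    have e : ∀ q : ℝ × ℝ, F (p, q) = ((χ (p.1 ^ 2 + p.2 ^ 2) : ℂ) *
        Complex.exp (Complex.I * t * sumCubic p.1 p.2)) *
        (J (t * (-(3 / 4) * p.1)) q.1 * J (t * (-(3 / 4) * p.2)) q.2) := by
      intro q
      have e2 : Complex.exp (Complex.I * t * phase (p, q)) =
          Complex.exp (Complex.I * t * sumCubic p.1 p.2) *
          (Complex.exp (Complex.I * (t * (-(3 / 4) * p.1) : ℝ) * q.1 ^ 2) *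
            Complex.exp (Complex.I * (t * (-(3 / 4) * p.2) : ℝ) * q.2 ^ 2)) := by
        rw [← Complex.exp_add, ← Complex.exp_add]
        simp only [phase]
        push_cast
        ring_nf
      simp only [hF, J, e2]
      ring
    have e3 := integral_prod_mul (μ := (volume : Measure ℝ)) (ν := (volume : Measure ℝ))
      (J (t * (-(3 / 4) * p.1))) (J (t * (-(3 / 4) * p.2)))
    rw [← Measure.volume_eq_prod] at e3
    simp only [e]
    rw [integral_const_mul, e3, hχ.integral_comp_sq_mul_cexp, hχ.integral_comp_sq_mul_cexp]
    ring
  have hfub := integral_prod F hFint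
  have hint := hFint.integral_prod_left
  simp only [hinner] at hfub hint
  refine ⟨?_, ?_⟩
  · refine (hint.const_mul (1 / 4)).congr (Eventually.of_forall fun p => ?_)
    simp only
    ring
  · rw [hosc, hfub, integral_const_mul]
    push_cast
    ring

theorem IsCutoff.exists_oscillatoryIntegral_cubicP4_sub_isBigO {χ : ℝ → ℝ} (hχ : IsCutoff χ) :
    ∃ c : ℂ, c ≠ 0 ∧ (fun t : ℝ => oscillatoryIntegral cubicP4 (amplitude χ) t -
      c * ((t ^ (-(4 / 3) : ℝ) : ℝ) : ℂ))
        =O[atTop] (fun t : ℝ => t ^ (-(3 / 2) : ℝ) * Real.log t) := by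
  obtain ⟨k, hk, hosc⟩ := hχ.exists_oscillatoryIntegral_cubicP4_eq
  obtain ⟨C₁, hC₁, h₁⟩ := hχ.exists_norm_integral_sub_integral_fresnel_le
  obtain ⟨C₂, hC₂, h₂⟩ := exists_norm_integral_sumCubic_sub_le hχ
  refine ⟨k * leadingCoeff, mul_ne_zero (by exact_mod_cast hk) leadingCoeff_ne_zero,
    IsBigO.of_bound (|k| * (C₁ + C₂)) ?_⟩
  filter_upwards [eventually_ge_atTop (Real.exp 2)] with t ht
  have ht0 : 0 < t := (Real.exp_pos 2).trans_le ht
  have hlog : 2 ≤ Real.log t := (Real.le_log_iff_exp_le ht0).2 ht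
  obtain ⟨hint, heq⟩ := hosc t
  have b₁ := h₁ t ht hint
  have b₂ := h₂ t ht0
  rw [heq, mul_assoc, ← mul_sub, norm_mul, Complex.norm_real, Real.norm_eq_abs,
    Real.norm_of_nonneg (by positivity), mul_assoc]
  gcongr
  have hp : 0 ≤ t ^ (-(3 / 2) : ℝ) := by positivity
  refine (norm_sub_le_norm_sub_add_norm_sub _ _ _).trans ((add_le_add b₁ b₂).trans ?_)
  rw [add_mul]
  gcongr
  nlinarith

theorem contDiff_amplitude {χ : ℝ → ℝ} (hχ : IsCutoff χ) : ContDiff ℝ ∞ (amplitude χ) := by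
  have := hχ.contDiff
  unfold amplitude
  fun_prop

theorem amplitude_zero {χ : ℝ → ℝ} (hχ : IsCutoff χ) : amplitude χ 0 = 1 := by
  simp [amplitude, hχ.eventually_eq_one.self_of_nhds]

/-- Each coordinate is half the sum or difference of one of the sums and
one of the differences, both at most `ε` in absolute value on the support. -/
theorem abs_le_of_amplitude_ne_zero {χ : ℝ → ℝ} {ε : ℝ} (hε : 0 ≤ ε)
    (hsupp : ∀ r, χ r ≠ 0 → |r| ≤ ε ^ 2) {ξ : Fin 4 → ℝ} (h : amplitude χ ξ ≠ 0) (j : Fin 4) :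
    |ξ j| ≤ ε := by
  have h1 := (le_abs_self _).trans (hsupp _ (left_ne_zero_of_mul h))
  have h2 := (le_abs_self _).trans (hsupp _ (left_ne_zero_of_mul (right_ne_zero_of_mul h)))
  have h3 := (le_abs_self _).trans (hsupp _ (right_ne_zero_of_mul (right_ne_zero_of_mul h)))
  refine abs_le_of_sq_le_sq ?_ hε
  fin_cases j <;> simp only [Fin.zero_eta, Fin.mk_one, Fin.reduceFinMk] <;>
    nlinarith [sq_nonneg (ξ 0 + ξ 1), sq_nonneg (ξ 2 + ξ 3), sq_nonneg (ξ 0), sq_nonneg (ξ 1),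
      sq_nonneg (ξ 2), sq_nonneg (ξ 3)]

theorem exists_isCutoff {ε : ℝ} (hε : 0 < ε) :
    ∃ χ : ℝ → ℝ, IsCutoff χ ∧ ∀ r, χ r ≠ 0 → |r| ≤ ε := by
  let f : ContDiffBump (0 : ℝ) := ⟨ε / 2, ε, by positivity, by linarith⟩
  refine ⟨f, ⟨f.contDiff, f.hasCompactSupport, f.eventuallyEq_one⟩, fun r hr => ?_⟩
  have : r ∈ Function.support f := hr
  rw [f.support_eq] at this
  have := Metric.mem_ball.1 this
  rw [Real.dist_eq, sub_zero] at this
  exact this.le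

/-! ### Asymptotics on `ℝ⁵` -/

/-- The splitting of `ℝ⁵` into its first four coordinates and the last one. -/
noncomputable def initLastEquiv : (Fin 5 → ℝ) ≃L[ℝ] (Fin 4 → ℝ) × ℝ :=
  LinearEquiv.toContinuousLinearEquiv
    { toFun := fun z => (fun j => z j.castSucc, z (Fin.last 4))
      map_add' := fun _ _ => rfl
      map_smul' := fun _ _ => rfl
      invFun := fun p => Fin.snoc (α := fun _ => ℝ) p.1 p.2
      left_inv := fun z => Fin.snoc_init_self z
      right_inv := fun p => Prod.ext (funext fun j => Fin.snoc_castSucc (α := fun _ => ℝ) p.2 p.1 j)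
        (Fin.snoc_last (α := fun _ => ℝ) p.2 p.1) }

theorem initLastEquiv_apply (z : Fin 5 → ℝ) :
    initLastEquiv z = (fun j => z j.castSucc, z (Fin.last 4)) := rfl

/-- The amplitude on `ℝ⁵`: the amplitude on `ℝ⁴` times a cutoff in the last variable. -/
noncomputable def amplitudeFive (χ : ℝ → ℝ) (z : Fin 5 → ℝ) : ℝ :=
  amplitude χ (fun j => z j.castSucc) * χ (z (Fin.last 4) ^ 2)

/-- The phase is a sum of functions of separate variables, so the integral on `ℝ⁵` factors. -/
theorem IsCutoff.exists_oscillatoryIntegral_phaseP4_eq {χ : ℝ → ℝ} (hχ : IsCutoff χ) :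
    ∃ k : ℝ, k ≠ 0 ∧ ∀ q t : ℝ, oscillatoryIntegral (phaseP4 q) (amplitudeFive χ) t =
      k * (oscillatoryIntegral cubicP4 (amplitude χ) t *
        cutoffFresnel 2 (fun r => χ (r ^ 2)) (t * q)) := by
  obtain ⟨k, hk, hchange⟩ := exists_integral_comp_continuousLinearEquiv initLastEquiv
    (volume : Measure (Fin 5 → ℝ)) ((volume : Measure (Fin 4 → ℝ)).prod (volume : Measure ℝ))
  refine ⟨k * 2, mul_ne_zero hk (by norm_num), fun q t => ?_⟩
  set f : (Fin 4 → ℝ) → ℂ := fun ξ =>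
    Complex.exp (Complex.I * (t : ℂ) * (cubicP4 ξ : ℂ)) * (amplitude χ ξ : ℂ)
  set g : ℝ → ℂ := fun v => (χ (v ^ 2) : ℂ) * Complex.exp (Complex.I * (t * q : ℝ) * v ^ 2)
  have h : oscillatoryIntegral (phaseP4 q) (amplitudeFive χ) t =
      ∫ z : Fin 5 → ℝ, (fun p : (Fin 4 → ℝ) × ℝ => f p.1 * g p.2) (initLastEquiv z) := by
    rw [oscillatoryIntegral]
    congr 1
    funext z
    simp only [f, g, initLastEquiv_apply, phaseP4, amplitudeFive]
    have e : Complex.exp (Complex.I * t * ((cubicP4 (fun j : Fin 4 => z j.castSucc) +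
        q * z (Fin.last 4) ^ 2 : ℝ) : ℂ)) =
        Complex.exp (Complex.I * t * (cubicP4 (fun j : Fin 4 => z j.castSucc) : ℂ)) *
          Complex.exp (Complex.I * (t * q : ℝ) * z (Fin.last 4) ^ 2) := by
      rw [← Complex.exp_add]
      push_cast
      ring_nf
    rw [e]
    push_cast
    ring
  rw [h, hchange (fun p => f p.1 * g p.2), integral_prod_mul, hχ.integral_comp_sq_mul_cexp, oscillatoryIntegral]
  push_cast
  ring

theorem IsCutoff.exists_oscillatoryIntegral_phaseP4_sub_isBigO {χ : ℝ → ℝ} (hχ : IsCutoff χ)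
    {q : ℝ} (hq : q ≠ 0) :
    ∃ c : ℂ, c ≠ 0 ∧ (fun t : ℝ => oscillatoryIntegral (phaseP4 q) (amplitudeFive χ) t -
      c * ((t ^ (-(11 / 6) : ℝ) : ℝ) : ℂ)) =O[atTop] (fun t : ℝ => t ^ (-2 : ℝ) * Real.log t) := by
  obtain ⟨k, hk, hosc⟩ := hχ.exists_oscillatoryIntegral_phaseP4_eq
  obtain ⟨c, hc, hmain⟩ := hχ.exists_oscillatoryIntegral_cubicP4_sub_isBigO
  obtain ⟨C, hC, hrem⟩ := hχ.comp_sq.exists_norm_sub_fresnel_le (p := 2) le_rfl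
  set K := cutoffFresnel 2 (fun r => χ (r ^ 2))
  have hscale : ∀ t : ℝ, 0 < t →
      fresnel 2 (t * q) = ((t ^ (-(1 / 2) : ℝ) : ℝ) : ℂ) * fresnel 2 q := fun t ht => by
    simpa using fresnel_mul (p := 2) ht q
  have hK : (fun t : ℝ => K (t * q) - ((t ^ (-(1 / 2) : ℝ) : ℝ) : ℂ) * fresnel 2 q)
      =O[atTop] (fun t : ℝ => t ^ (-1 : ℝ)) := by
    refine IsBigO.of_bound (C / |q|) ?_
    filter_upwards [eventually_gt_atTop 0] with t ht
    have := hrem (t * q) (mul_ne_zero ht.ne' hq)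
    rw [hscale t ht, abs_mul, abs_of_pos ht] at this
    rw [Real.rpow_neg_one, norm_inv, Real.norm_of_nonneg ht.le]
    refine this.trans_eq ?_
    rw [mul_comm t, ← div_div, div_eq_mul_inv _ t]
  have hpow : ∀ a b : ℝ, a ≤ b →
      (fun t : ℝ => t ^ a) =O[atTop] (fun t : ℝ => t ^ b) := fun a b hab => by
    refine IsBigO.of_bound 1 ?_
    filter_upwards [eventually_ge_atTop 1] with t ht
    rw [one_mul, Real.norm_of_nonneg (by positivity), Real.norm_of_nonneg (by positivity)]
    exact Real.rpow_le_rpow_of_exponent_le ht hab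
  have hcast : ∀ a : ℝ, (fun t : ℝ => ((t ^ a : ℝ) : ℂ)) =O[atTop] (fun t : ℝ => t ^ a) :=
    fun a => IsBigO.of_bound 1 (Eventually.of_forall fun t => by simp)
  have hK2 : (fun t : ℝ => K (t * q)) =O[atTop] (fun t : ℝ => t ^ (-(1 / 2) : ℝ)) := by
    have h1 : (fun t : ℝ => ((t ^ (-(1 / 2) : ℝ) : ℝ) : ℂ) * fresnel 2 q) =O[atTop]
        (fun t : ℝ => t ^ (-(1 / 2) : ℝ)) := by
      simpa [mul_comm] using (hcast (-(1 / 2))).const_mul_left (fresnel 2 q)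
    simpa using (hK.trans (hpow (-1) (-(1 / 2)) (by norm_num))).add h1
  have hlog : (fun t : ℝ => t ^ (-2 : ℝ)) =O[atTop] (fun t : ℝ => t ^ (-2 : ℝ) * Real.log t) := by
    refine IsBigO.of_bound 1 ?_
    filter_upwards [eventually_ge_atTop (Real.exp 1)] with t ht
    have ht0 : 0 < t := (Real.exp_pos 1).trans_le ht
    have hlog : 1 ≤ Real.log t := (Real.le_log_iff_exp_le ht0).2 ht
    rw [one_mul, norm_mul, Real.norm_of_nonneg (by linarith : 0 ≤ Real.log t)]
    exact le_mul_of_one_le_right (norm_nonneg _) hlog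
  have herr1 : (fun t : ℝ => (oscillatoryIntegral cubicP4 (amplitude χ) t -
      c * ((t ^ (-(4 / 3) : ℝ) : ℝ) : ℂ)) * K (t * q)) =O[atTop]
      (fun t : ℝ => t ^ (-2 : ℝ) * Real.log t) := by
    refine (hmain.mul hK2).congr' EventuallyEq.rfl ?_
    filter_upwards [eventually_gt_atTop 0] with t ht
    rw [mul_right_comm, ← Real.rpow_add ht]
    norm_num
  have herr2 : (fun t : ℝ => c * (((t ^ (-(4 / 3) : ℝ) : ℝ) : ℂ) *
      (K (t * q) - ((t ^ (-(1 / 2) : ℝ) : ℝ) : ℂ) * fresnel 2 q))) =O[atTop]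
      (fun t : ℝ => t ^ (-2 : ℝ) * Real.log t) := by
    refine IsBigO.const_mul_left ?_ c
    refine (((hcast (-(4 / 3))).mul hK).congr' EventuallyEq.rfl ?_).trans
      ((hpow (-(7 / 3)) (-2) (by norm_num)).trans hlog)
    filter_upwards [eventually_gt_atTop 0] with t ht
    rw [← Real.rpow_add ht]
    norm_num
  refine ⟨k * (c * fresnel 2 q), mul_ne_zero (by exact_mod_cast hk)
    (mul_ne_zero hc (fresnel_ne_zero hq)), ?_⟩
  refine ((herr1.add herr2).const_mul_left (k : ℂ)).congr' ?_ EventuallyEq.rfl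
  filter_upwards [eventually_gt_atTop 0] with t ht
  have e : ((t ^ (-(11 / 6) : ℝ) : ℝ) : ℂ) =
      ((t ^ (-(4 / 3) : ℝ) : ℝ) : ℂ) * ((t ^ (-(1 / 2) : ℝ) : ℝ) : ℂ) := by
    rw [← Complex.ofReal_mul, ← Real.rpow_add ht]
    norm_num
  rw [hosc, e]
  ring

theorem mainTheorem6 :
    (∃ (ψ : (Fin 4 → ℝ) → ℝ) (c : ℂ),
      ContDiff ℝ ∞ ψ ∧ HasCompactSupport ψ ∧ ψ 0 ≠ 0 ∧ c ≠ 0 ∧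
      (fun t : ℝ => oscillatoryIntegral cubicP4 ψ t - c * ((t ^ (-(4 / 3) : ℝ) : ℝ) : ℂ))
        =O[atTop] (fun t : ℝ => t ^ (-(3 / 2) : ℝ) * Real.log t)) ∧
    (∀ q : ℝ, q ≠ 0 → ∀ U ∈ 𝓝 (0 : Fin 5 → ℝ),
      ∃ (ψ : (Fin 5 → ℝ) → ℝ) (c : ℂ),
        ContDiff ℝ ∞ ψ ∧ HasCompactSupport ψ ∧ tsupport ψ ⊆ U ∧ ψ 0 ≠ 0 ∧ c ≠ 0 ∧
        (fun t : ℝ => oscillatoryIntegral (phaseP4 q) ψ t - c * ((t ^ (-(11 / 6) : ℝ) : ℝ) : ℂ))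
          =O[atTop] (fun t : ℝ => t ^ (-2 : ℝ) * Real.log t)) := by
  constructor
  · obtain ⟨χ, hχ, hsupp⟩ := exists_isCutoff (ε := 1 ^ 2) (by norm_num)
    obtain ⟨c, hc, h⟩ := hχ.exists_oscillatoryIntegral_cubicP4_sub_isBigO
    refine ⟨amplitude χ, c, contDiff_amplitude hχ, ?_, by simp [amplitude_zero hχ], hc, h⟩
    refine HasCompactSupport.of_support_subset_isCompact
      (isCompact_closedBall (0 : Fin 4 → ℝ) 1) fun ξ hξ => ?_
    rw [mem_closedBall_zero_iff, pi_norm_le_iff_of_nonneg zero_le_one]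
    exact abs_le_of_amplitude_ne_zero zero_le_one hsupp hξ
  · intro q hq U hU
    obtain ⟨ε, hε, hball⟩ := Metric.nhds_basis_closedBall.mem_iff.1 hU
    obtain ⟨χ, hχ, hsupp⟩ := exists_isCutoff (ε := ε ^ 2) (by positivity)
    obtain ⟨c, hc, h⟩ := hχ.exists_oscillatoryIntegral_phaseP4_sub_isBigO hq
    have hsub : Function.support (amplitudeFive χ) ⊆ Metric.closedBall 0 ε := fun z hz => by
      rw [mem_closedBall_zero_iff, pi_norm_le_iff_of_nonneg hε.le]
      intro j
      refine Fin.lastCases ?_ (fun i => ?_) j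
      · exact abs_le_of_sq_le_sq ((le_abs_self _).trans (hsupp _ (right_ne_zero_of_mul hz))) hε.le
      · exact abs_le_of_amplitude_ne_zero hε.le hsupp (left_ne_zero_of_mul hz) i
    refine ⟨amplitudeFive χ, c, ?_, HasCompactSupport.of_support_subset_isCompact
      (isCompact_closedBall _ _) hsub,
      (closure_minimal hsub Metric.isClosed_closedBall).trans hball, ?_, hc, h⟩
    · have h1 := contDiff_amplitude hχ
      have h2 := hχ.contDiff
      unfold amplitudeFive
      exact (h1.comp (by fun_prop)).mul (h2.comp (by fun_prop))
    · have h1 : amplitude χ (fun _ : Fin 4 => 0) = 1 := amplitude_zero hχ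
      simp [amplitudeFive, h1, hχ.eventually_eq_one.self_of_nhds]
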